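/- Let $\mathfrak g=\mathfrak{sp}(2n)$ or $\mathfrak g=\mathfrak{sl}(n+1)$ over $\mathbb C$ with $n\ge 1$, let $\mathfrak h$ be a Cartan subalgebra, $\Delta\subset\mathfrak h^*$ the root system, $U=U(\mathfrak g)$, and for every $\alpha\in\Delta$ fix a standard triple $e_\alpha\in\mathfrak g^{\alpha}$, $f_\alpha\in\mathfrak g^{-\alpha}$, $h_\alpha=[e_\alpha,f_\alpha]$. A $\mathfrak g$-module $M$ is in the category $\mathcal B$ of bounded modules if $M=\bigoplus_{\mu\in\mathfrak h^*}M^\mu$ is a weight module, the weight multiplicities $\dim M^\mu$ are uniformly bounded by a finite constant, and $M$ has a generalized central character, i.e. there is an algebra homomorphism $\chi:Z(U)\to\mathbb C$ such that for all $z\in Z(U)$, $m\in M$ one has $(z-\chi(z))^Nm=0$ for some $N$. Put $\operatorname{supp}M=\{\mu\in\mathfrak h^*\mid M^\mu\ne0\}$. Let $\Gamma=\{\gamma_1,\dots,\gamma_l\}\subset\Delta$ be linearly independent with $\gamma_i+\gamma_j\notin\Delta$ for all $i,j$. A module $M$ is $\Gamma$-injective ($\Gamma$-bijective) if $f_\gamma$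 acts injectively (bijectively) on $M$ for every $\gamma\in\Gamma$. Let $F_\Gamma\subset U$ be the multiplicative set generated by $f_{\gamma_1},\dots,f_{\gamma_l}$ (an Ore set), $U_{F_\Gamma}$ the localization of $U$ at $F_\Gamma$, and $\mathcal D_\Gamma M=U_{F_\Gamma}\otimes_UM$. For $\mu=x_1\gamma_1+\dots+x_l\gamma_l\in\operatorname{Span}_{\mathbb C}\Gamma$ let $\mathcal D_\Gamma^\mu M$ be the space $\mathcal D_\Gamma M$ on which $u\in U_{F_\Gamma}$ acts as $$\Theta_{(x_1,\dots,x_l)}(u)=\sum_{i_1,\dots,i_l\ge0}\binom{x_1}{i_1}\cdots\binom{x_l}{i_l}\,\operatorname{ad}(f_{\gamma_1})^{i_1}\cdots\operatorname{ad}(f_{\gamma_l})^{i_l}(u)\,f_{\gamma_1}^{-i_1}\cdots f_{\gamma_l}^{-i_l}$$ acts on $\mathcal D_\Gamma M$ (the sum is finite); $\mathcal D_\Gamma M$ and $\mathcal D^\mu_\Gamma M$ are regarded as $\mathfrak g$-modules. Let $M$ be a $\Gamma$-injective $\mathfrak g$-module in $\mathcal B$. Then: (i) $\mathcal D_\Gamma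 M\simeq M$ as $\mathfrak g$-modules if and only if $M$ is $\Gamma$-bijective. (ii) For every $\mu\in\operatorname{Span}_{\mathbb C}\Gamma$, $\operatorname{supp}\mathcal D_\Gamma^\mu M=\mu+\operatorname{supp}M+\operatorname{Span}_{\mathbb Z}\Gamma$. Moreover, if $\nu_0\in\operatorname{supp}M$ and $\nu'\in\mu+\nu_0+\operatorname{Span}_{\mathbb Z}\Gamma$, then $(\mathcal D_\Gamma^\mu M)^{\nu'}$ is finite-dimensional and $$\dim(\mathcal D_\Gamma^\mu M)^{\nu'}=\max\{\dim M^\nu\mid\nu\in\nu_0+\operatorname{Span}_{\mathbb Z}\Gamma\}.$$ (iii) If $M$ has a unique simple submodule and $M$ is indecomposable, then $\mathcal D_\Gamma^\mu M$ is an indecomposable $\mathfrak g$-module for every $\mu\in\operatorname{Span}_{\mathbb C}\Gamma$. -/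

import Mathlib

namespace TwistedLoc

attribute [local instance] LieRing.ofAssociativeRing

/-- `𝔤` is (isomorphic to) `𝔰𝔭(2n)` or `𝔰𝔩(n+1)` over `ℂ` for some `n ≥ 1`. -/
class IsSpOrSl (g : Type*) [LieRing g] [LieAlgebra ℂ g] : Prop where
  exists_equiv : ∃ n : ℕ, 1 ≤ n ∧
    (Nonempty (g ≃ₗ⁅ℂ⁆ LieAlgebra.Symplectic.sp (Fin n) ℂ) ∨
      Nonempty (g ≃ₗ⁅ℂ⁆ LieAlgebra.SpecialLinear.sl (Fin (n + 1)) ℂ))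

open Matrix in
theorem isKilling_sl (n : ℕ) (hn : 1 ≤ n) :
    LieAlgebra.IsKilling ℂ (LieAlgebra.SpecialLinear.sl (Fin (n + 1)) ℂ) := by
  have : LieModule.IsIrreducible ℂ (LieAlgebra.SpecialLinear.sl (Fin (n + 1)) ℂ)
      (Fin (n + 1) → ℂ) := by
    refine LieModule.IsIrreducible.mk fun N hN => ?_
    obtain ⟨v, hv, hv0⟩ : ∃ v ∈ N, v ≠ 0 := by
      by_contra! h
      exact hN ((LieSubmodule.eq_bot_iff N).mpr h)
    obtain ⟨j, hj⟩ := Function.ne_iff.mp hv0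
    have key : ∀ (i j : Fin (n + 1)) (_ : i ≠ j) (u : Fin (n + 1) → ℂ), u ∈ N → u j ≠ 0 →
        Pi.single i (1 : ℂ) ∈ N := by
      intro i j hij u hu huj
      have h1 := N.lie_mem (x := LieAlgebra.SpecialLinear.single i j hij (1 : ℂ)) hu
      have h2 : ⁅LieAlgebra.SpecialLinear.single i j hij (1 : ℂ), u⁆
          = u j • Pi.single i (1 : ℂ) := by
        change (Matrix.single i j (1 : ℂ)) *ᵥ u = _
        ext k
        by_cases hk : k = i
        · subst hk; simp [Matrix.single_mulVec]
        · simp [Matrix.single_mulVec, hk]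
      rw [h2] at h1
      have h3 := N.smul_mem (u j)⁻¹ h1
      rwa [smul_smul, inv_mul_cancel₀ huj, one_smul] at h3
    have all : ∀ i, Pi.single i (1 : ℂ) ∈ N := by
      intro i
      by_cases hij : i = j
      · subst hij
        have : Nontrivial (Fin (n + 1)) := Fin.nontrivial_iff_two_le.mpr (by omega)
        obtain ⟨k, hk⟩ := exists_ne i
        exact key i k hk.symm _ (key k i hk v hv hj) (by simp)
      · exact key i j hij v hv hj
    rw [eq_top_iff]
    intro u _
    rw [pi_eq_sum_univ' u]
    exact sum_mem fun i _ => N.smul_mem _ (by simpa [Pi.single_apply, eq_comm] using! all i)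
  have : LieModule.IsFaithful ℂ (LieAlgebra.SpecialLinear.sl (Fin (n + 1)) ℂ)
      (Fin (n + 1) → ℂ) := inferInstance
  have := LieAlgebra.hasTrivialRadical_of_isIrreducible_of_isFaithful ℂ
    (LieAlgebra.SpecialLinear.sl (Fin (n + 1)) ℂ) (Fin (n + 1) → ℂ) (by
      intro x
      have hx : Matrix.trace x.1 = 0 := x.2
      have : LieModule.toEnd ℂ _ (Fin (n + 1) → ℂ) x = Matrix.toLin' x.1 := by ext; rfl
      rw [this, Matrix.trace_toLin'_eq, hx])
  infer_instance

open Matrix in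
theorem isKilling_sp (n : ℕ) (hn : 1 ≤ n) :
    LieAlgebra.IsKilling ℂ (LieAlgebra.Symplectic.sp (Fin n) ℂ) := by
  have : Nonempty (Fin n) := ⟨⟨0, hn⟩⟩
  have hmem (w : Fin n ⊕ Fin n → ℂ) :
      Matrix.vecMulVec w w * Matrix.J (Fin n) ℂ ∈ LieAlgebra.Symplectic.sp (Fin n) ℂ := by
    rw [LieAlgebra.Symplectic.sp, mem_skewAdjointMatricesLieSubalgebra,
      mem_skewAdjointMatricesSubmodule]
    simp only [Matrix.IsSkewAdjoint, Matrix.IsAdjointPair]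
    rw [Matrix.transpose_mul, Matrix.transpose_vecMulVec, Matrix.J_transpose]
    simp [Matrix.mul_assoc]
  have : LieModule.IsIrreducible ℂ (LieAlgebra.Symplectic.sp (Fin n) ℂ)
      (Fin n ⊕ Fin n → ℂ) := by
    refine LieModule.IsIrreducible.mk fun N hN => ?_
    obtain ⟨u, hu, hu0⟩ : ∃ u ∈ N, u ≠ 0 := by
      by_contra! h
      exact hN ((LieSubmodule.eq_bot_iff N).mpr h)
    set y := Matrix.J (Fin n) ℂ *ᵥ u with hy
    have hy0 : y ≠ 0 := by
      intro h
      apply hu0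
      have : Matrix.J (Fin n) ℂ *ᵥ y = 0 := by rw [h, Matrix.mulVec_zero]
      rw [hy, Matrix.mulVec_mulVec, Matrix.J_squared] at this
      simpa [Matrix.neg_mulVec] using this
    obtain ⟨k, hk⟩ := Function.ne_iff.mp hy0
    have key : ∀ w : Fin n ⊕ Fin n → ℂ, w ⬝ᵥ y ≠ 0 → w ∈ N := by
      intro w hw
      have h1 := N.lie_mem (x := ⟨_, hmem w⟩) hu
      have h2 : ⁅(⟨_, hmem w⟩ : LieAlgebra.Symplectic.sp (Fin n) ℂ), u⁆ = (w ⬝ᵥ y) • w := by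
        change (Matrix.vecMulVec w w * Matrix.J (Fin n) ℂ) *ᵥ u = _
        rw [← Matrix.mulVec_mulVec, ← hy, Matrix.vecMulVec_mulVec]
        simp
      rw [h2] at h1
      have h3 := N.smul_mem (w ⬝ᵥ y)⁻¹ h1
      rwa [smul_smul, inv_mul_cancel₀ hw, one_smul] at h3
    have hk' : Pi.single k (1 : ℂ) ⬝ᵥ y ≠ 0 := by simpa using hk
    rw [eq_top_iff]
    intro w _
    by_cases hw : w ⬝ᵥ y = 0
    · have := N.sub_mem (key (w + Pi.single k 1) (by rwa [add_dotProduct, hw, zero_add]))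
        (key _ hk')
      simpa using this
    · exact key w hw
  have := LieAlgebra.hasTrivialRadical_of_isIrreducible_of_isFaithful ℂ
    (LieAlgebra.Symplectic.sp (Fin n) ℂ) (Fin n ⊕ Fin n → ℂ) (by
      intro x
      have hx : x.1ᵀ * Matrix.J (Fin n) ℂ = Matrix.J (Fin n) ℂ * (-x.1) :=
        (mem_skewAdjointMatricesSubmodule _ _).mp
          ((mem_skewAdjointMatricesLieSubalgebra _ _).mp x.2)
      have : LieModule.toEnd ℂ _ (Fin n ⊕ Fin n → ℂ) x = Matrix.toLin' x.1 := by ext; rfl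
      rw [this, Matrix.trace_toLin'_eq]
      have h2 : Matrix.trace (x.1ᵀ * Matrix.J (Fin n) ℂ * Matrix.J (Fin n) ℂ)
          = Matrix.trace (Matrix.J (Fin n) ℂ * (-x.1) * Matrix.J (Fin n) ℂ) := by rw [hx]
      rw [Matrix.trace_mul_comm (Matrix.J (Fin n) ℂ * (-x.1)), ← Matrix.mul_assoc,
        Matrix.mul_assoc x.1ᵀ, Matrix.J_squared] at h2
      simp [Matrix.trace_transpose] at h2
      exact self_eq_neg.mp h2.symm)
  infer_instance

section LieTheory

variable {g : Type*} [LieRing g] [LieAlgebra ℂ g]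

instance IsSpOrSl.isKilling [IsSpOrSl g] : LieAlgebra.IsKilling ℂ g := by
  obtain ⟨n, hn, ⟨⟨e⟩⟩ | ⟨⟨e⟩⟩⟩ := IsSpOrSl.exists_equiv (g := g)
  · have := isKilling_sp n hn
    exact LieAlgebra.isKilling_of_equiv e.symm
  · have := isKilling_sl n hn
    exact LieAlgebra.isKilling_of_equiv e.symm

instance IsSpOrSl.finiteDimensional [IsSpOrSl g] : FiniteDimensional ℂ g := by
  obtain ⟨n, hn, ⟨⟨e⟩⟩ | ⟨⟨e⟩⟩⟩ := IsSpOrSl.exists_equiv (g := g)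
  · exact Module.Finite.equiv e.symm.toLinearEquiv
  · exact Module.Finite.equiv e.symm.toLinearEquiv

/-- The root system `Δ(𝔤, 𝔥)`: nonzero `α ∈ 𝔥*` with nonzero root space. -/
def roots (H : LieSubalgebra ℂ g) [H.IsCartanSubalgebra] : Set (Module.Dual ℂ H) :=
  {α | α ≠ 0 ∧ LieAlgebra.rootSpace H α ≠ ⊥}

/-- A choice, for every root `α`, of a standard triple `e_α ∈ 𝔤^α`, `f_α ∈ 𝔤^{-α}`,
`h_α = [e_α, f_α]`. The values at non-roots are irrelevant. -/
structure StandardTriples (H : LieSubalgebra ℂ g) [H.IsCartanSubalgebra] where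
  e : Module.Dual ℂ H → g
  f : Module.Dual ℂ H → g
  h : Module.Dual ℂ H → g
  e_mem : ∀ α ∈ roots H, e α ∈ LieAlgebra.rootSpace H α
  f_mem : ∀ α ∈ roots H, f α ∈ LieAlgebra.rootSpace H (-α)
  isSl2Triple : ∀ α ∈ roots H, IsSl2Triple (h α) (e α) (f α)

/-- A set `Γ = {γ_1, …, γ_l}` of linearly independent roots with `γ_i + γ_j ∉ Δ` for all
`i`, `j`. -/
structure CommutingRoots (H : LieSubalgebra ℂ g) [H.IsCartanSubalgebra] (l : ℕ) where
  root : Fin l → Module.Dual ℂ H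
  root_mem : ∀ j, root j ∈ roots H
  linearIndependent : LinearIndependent ℂ root
  add_notMem : ∀ i j, root i + root j ∉ roots H

variable {H : LieSubalgebra ℂ g} [H.IsCartanSubalgebra] {l : ℕ}

/-- The elements `f_γ`, `γ ∈ Γ`, commute. -/
theorem lie_f_f [IsSpOrSl g] (T : StandardTriples H) (Γ : CommutingRoots H l) (i j : Fin l) :
    ⁅T.f (Γ.root i), T.f (Γ.root j)⁆ = 0 := by
  by_cases hij : i = j
  · subst hij; exact lie_self _
  by_contra hne
  have h0 : Γ.root i + Γ.root j ≠ 0 := by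
    intro h
    have h1 := Fintype.linearIndependent_iff.mp Γ.linearIndependent
      (fun k => (if k = i then 1 else 0) + (if k = j then 1 else 0))
      (by simpa [add_smul, Finset.sum_add_distrib] using h) i
    simp [hij] at h1
  apply Γ.add_notMem i j
  refine ⟨h0, fun hbot => hne ?_⟩
  have h1 := LieAlgebra.lie_mem_genWeightSpace_of_mem_genWeightSpace
    (T.f_mem _ (Γ.root_mem i)) (T.f_mem _ (Γ.root_mem j))
  by_contra hne'
  have hw : LieModule.genWeightSpace g (-(Γ.root i) + -(Γ.root j) : H → ℂ) ≠ ⊥ := by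
    intro hb; erw [hb] at h1; exact hne' (by simpa using h1)
  let α : LieModule.Weight ℂ H g := ⟨_, hw⟩
  have := (-α).genWeightSpace_ne_bot
  apply this
  have h2 : ((-α : LieModule.Weight ℂ H g) : H → ℂ) = ⇑(Γ.root i + Γ.root j) := by
    ext x
    rw [LieModule.Weight.coe_neg]
    simp [α]
    ring
  rw [h2]
  exact hbot

theorem isNilpotent_ad_f [IsSpOrSl g] (T : StandardTriples H) (Γ : CommutingRoots H l)
    (i : Fin l) : IsNilpotent (LieAlgebra.ad ℂ g (T.f (Γ.root i))) := by
  refine LieAlgebra.isNilpotent_ad_of_mem_rootSpace H ?_ (T.f_mem _ (Γ.root_mem i))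
  intro h
  apply (Γ.root_mem i).1
  ext x
  simpa using congrFun h x

end LieTheory


section Generalities
variable {A : Type*} [Ring A] [Algebra ℂ A]

/-- The commutator map `ad(a) : u ↦ a u - u a`. -/
def adEnd (a : A) : Module.End ℂ A := LinearMap.mulLeft ℂ a - LinearMap.mulRight ℂ a

@[simp] theorem adEnd_apply (a u : A) : adEnd a u = a * u - u * a := rfl

theorem exists_pow_mul_eq (a : A) (N : ℕ) :
    ∀ r : A, (adEnd a ^ N) r = 0 → ∃ r' : A, a ^ N * r = r' * a := by
  induction N with
  | zero => intro r hr; exact ⟨0, by simpa using hr⟩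
  | succ N ih =>
    intro r hr
    obtain ⟨r', hr'⟩ := ih (adEnd a r) (by rwa [pow_succ] at hr)
    refine ⟨a ^ N * r + r', ?_⟩
    rw [add_mul, ← hr', adEnd_apply]
    noncomm_ring

theorem pow_mul_eq_zero (a : A) (N : ℕ) :
    ∀ r : A, (adEnd a ^ N) r = 0 → r * a = 0 → a ^ N * r = 0 := by
  induction N with
  | zero => intro r hr _; simpa using hr
  | succ N ih =>
    intro r hr h0
    have h := ih (adEnd a r) (by rwa [pow_succ] at hr) (by
      rw [adEnd_apply, h0, sub_zero, mul_assoc, h0, mul_zero])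
    rw [adEnd_apply, h0, sub_zero, ← mul_assoc, ← pow_succ] at h
    exact h

theorem nonempty_oreSet_closure (s : Set A)
    (hs : ∀ a ∈ s, ∀ u : A, ∃ N : ℕ, (adEnd a ^ N) u = 0) :
    Nonempty (OreLocalization.OreSet (Submonoid.closure s)) := by
  rw [OreLocalization.nonempty_oreSet_iff]
  constructor
  · rintro r₁ r₂ ⟨t, ht⟩ h
    have key : ∀ r : A, r * t = 0 → ∃ t' : Submonoid.closure s, t' * r = 0 := by
      clear h
      induction ht using Submonoid.closure_induction with
      | mem a ha =>
        intro r hr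
        obtain ⟨N, hN⟩ := hs a ha r
        exact ⟨⟨a ^ N, pow_mem (Submonoid.subset_closure ha) N⟩, pow_mul_eq_zero a N r hN hr⟩
      | one => intro r hr; exact ⟨1, by simpa using hr⟩
      | mul x y _ _ hx hy =>
        intro r hr
        obtain ⟨t₁, h₁⟩ := hy (r * x) (by rwa [mul_assoc])
        obtain ⟨t₂, h₂⟩ := hx (t₁ * r) (by rwa [mul_assoc])
        exact ⟨t₂ * t₁, by rw [Submonoid.coe_mul, mul_assoc, h₂]⟩
    obtain ⟨t', ht'⟩ := key (r₁ - r₂) (by rw [sub_mul]; exact sub_eq_zero.mpr h)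
    exact ⟨t', by rwa [mul_sub, sub_eq_zero] at ht'⟩
  · rintro r ⟨t, ht⟩
    change ∃ (r' : A) (s' : Submonoid.closure s), (s' : A) * r = r' * t
    induction ht using Submonoid.closure_induction generalizing r with
    | mem a ha =>
      obtain ⟨N, hN⟩ := hs a ha r
      obtain ⟨r', hr'⟩ := exists_pow_mul_eq a N r hN
      exact ⟨r', ⟨a ^ N, pow_mem (Submonoid.subset_closure ha) N⟩, hr'⟩
    | one => exact ⟨r, 1, by simp⟩
    | mul x y _ _ hx hy =>
      obtain ⟨r₁, t₁, h₁⟩ := hy r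
      obtain ⟨r₂, t₂, h₂⟩ := hx r₁
      exact ⟨r₂, t₂ * t₁, by rw [Submonoid.coe_mul, mul_assoc, h₁, ← mul_assoc, h₂, mul_assoc]⟩

theorem adEnd_mul (a u v : A) : adEnd a (u * v) = adEnd a u * v + u * adEnd a v := by
  simp only [adEnd_apply]; noncomm_ring

theorem exists_adEnd_pow_mul (a : A) (n : ℕ) : ∀ (m k : ℕ) (u v : A), m + k ≤ n →
    (adEnd a ^ m) u = 0 → (adEnd a ^ k) v = 0 → (adEnd a ^ n) (u * v) = 0 := by
  induction n with
  | zero =>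
    intro m k u v h hu hv
    obtain rfl : m = 0 := by omega
    simp at hu; simp [hu]
  | succ n ih =>
    intro m k u v h hu hv
    rw [pow_succ, Module.End.mul_apply, adEnd_mul, map_add]
    have h1 : (adEnd a ^ n) (adEnd a u * v) = 0 := by
      rcases m with _ | m
      · simp at hu; simp [hu]
      · exact ih m k _ _ (by omega) (by rwa [pow_succ] at hu) hv
    have h2 : (adEnd a ^ n) (u * adEnd a v) = 0 := by
      rcases k with _ | k
      · simp at hv; simp [hv]
      · exact ih m k _ _ (by omega) hu (by rwa [pow_succ] at hv)
    rw [h1, h2, add_zero]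

/-- The subalgebra of elements on which `ad(a)` acts nilpotently. -/
def adNilpotent (a : A) : Subalgebra ℂ A where
  carrier := {u | ∃ N : ℕ, (adEnd a ^ N) u = 0}
  mul_mem' := by
    rintro u v ⟨m, hm⟩ ⟨k, hk⟩
    exact ⟨m + k, exists_adEnd_pow_mul a _ m k u v le_rfl hm hk⟩
  add_mem' := by
    rintro u v ⟨m, hm⟩ ⟨k, hk⟩
    exact ⟨max m k, by
      rw [map_add, Module.End.pow_map_zero_of_le le_sup_left hm,
        Module.End.pow_map_zero_of_le le_sup_right hk, add_zero]⟩
  algebraMap_mem' c := ⟨1, by simp [Algebra.commutes]⟩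

/-- The generalized conjugation by `f_1^{x_1} ⋯ f_l^{x_l}`. The family is finitely supported
when the units `f_j` commute and every `ad(f_j)` is locally nilpotent. -/
noncomputable def theta {l : ℕ} (f : Fin l → Aˣ) (x : Fin l → ℂ) (u : A) : A :=
  ∑ᶠ i : Fin l → ℕ, (∏ j, Ring.choose (x j) (i j)) •
    ((List.ofFn fun j => adEnd (f j : A) ^ i j).prod u *
      (List.ofFn fun j => (((f j)⁻¹ ^ i j : Aˣ) : A)).prod)

theorem exists_theta_eq {l : ℕ} (f : Fin l → Aˣ)
    (hf : ∀ i j, Commute (f i : A) (f j))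
    (hnil : ∀ j (u : A), ∃ N : ℕ, (adEnd (f j : A) ^ N) u = 0) :
    ∃ (C : Subalgebra ℂ (Module.End ℂ A)) (_ : ∀ a b : C, a * b = b * a) (t : Fin l → C),
      (∀ j u, (1 + t j : C).1 u = f j * u * ((f j)⁻¹ : Aˣ)) ∧
      (∀ j u, ∃ N : ℕ, (t j ^ N).1 u = 0) ∧
      ∀ (i : Fin l → ℕ) (u : A),
        (List.ofFn fun j => adEnd (f j : A) ^ i j).prod u *
          (List.ofFn fun j => (((f j)⁻¹ ^ i j : Aˣ) : A)).prod =
        ((List.ofFn fun j => t j ^ i j).prod).1 u := by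
  have hfi : ∀ i j, Commute (f i : A) ((f j)⁻¹ : Aˣ) := fun i j => (hf i j).units_inv_right
  have hii : ∀ i j, Commute (((f i)⁻¹ : Aˣ) : A) ((f j)⁻¹ : Aˣ) :=
    fun i j => (hfi i j).units_inv_left
  let S : Set (Module.End ℂ A) :=
    Set.range (fun j => LinearMap.mulLeft ℂ (f j : A)) ∪
    Set.range (fun j => LinearMap.mulRight ℂ (f j : A)) ∪
    Set.range (fun j => LinearMap.mulRight ℂ (((f j)⁻¹ : Aˣ) : A))
  have hS : ∀ a ∈ S, ∀ b ∈ S, a * b = b * a := by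
    rintro a ((⟨i, rfl⟩ | ⟨i, rfl⟩) | ⟨i, rfl⟩) b ((⟨j, rfl⟩ | ⟨j, rfl⟩) | ⟨j, rfl⟩) <;>
      ext u <;> simp only [Module.End.mul_apply, LinearMap.mulLeft_apply,
        LinearMap.mulRight_apply, ← mul_assoc]
    · rw [(hf i j).eq]
    · rw [mul_assoc, mul_assoc, (hf i j).eq]
    · rw [mul_assoc, mul_assoc, (hfi i j).eq]
    · rw [mul_assoc, mul_assoc, (hfi j i).eq]
    · rw [mul_assoc, mul_assoc, (hii i j).eq]
  let C := Algebra.adjoin ℂ S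
  have hC : IsMulCommutative C := Algebra.isMulCommutative_adjoin ℂ hS
  let _ : CommRing C := { (inferInstance : Ring C) with mul_comm := fun p q => mul_comm' p q }
  let a (j : Fin l) : C := ⟨_, Algebra.subset_adjoin (Or.inl (Or.inl ⟨j, rfl⟩))⟩
  let b (j : Fin l) : C := ⟨_, Algebra.subset_adjoin (Or.inl (Or.inr ⟨j, rfl⟩))⟩
  let c (j : Fin l) : C := ⟨_, Algebra.subset_adjoin (Or.inr ⟨j, rfl⟩)⟩
  have hcomm : ∀ p q : C, p * q = q * p := fun p q => mul_comm p q
  have hbc : ∀ j, b j * c j = 1 := by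
    intro j; apply Subtype.ext; ext u; simp [b, c]
  have ht : ∀ j (N : ℕ) , ((a j - b j) * c j) ^ N = (c j) ^ N * (a j - b j) ^ N := by
    intro j N; rw [mul_pow, mul_comm]
  have had : ∀ j, ((a j - b j : C) : Module.End ℂ A) = adEnd (f j : A) := fun j => rfl
  refine ⟨C, hcomm, fun j => (a j - b j) * c j, ?_, ?_, ?_⟩
  · intro j u
    have : 1 + (a j - b j) * c j = a j * c j := by rw [sub_mul, hbc]; ring
    rw [this]
    simp [a, c, mul_assoc]
  · intro j u
    obtain ⟨N, hN⟩ := hnil j u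
    refine ⟨N, ?_⟩
    rw [ht]
    change ((c j ^ N : C) : Module.End ℂ A) (((a j - b j) ^ N : C).1 u) = 0
    have : ((a j - b j) ^ N : C).1 = adEnd (f j : A) ^ N := by
      rw [← had]; rfl
    rw [this, hN, map_zero]
  · intro i u
    have h1 : ∀ L : List (Fin l), (L.map fun j => adEnd (f j : A) ^ i j).prod
        = ((L.map fun j => (a j - b j) ^ i j).prod : C).1 := by
      intro L
      induction L with
      | nil => rfl
      | cons j L ih =>
        rw [List.map_cons, List.prod_cons, List.map_cons, List.prod_cons, ih]; rfl
    have h2 : ∀ L : List (Fin l),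
        LinearMap.mulRight ℂ (L.map fun j => (((f j)⁻¹ ^ i j : Aˣ) : A)).prod
        = ((L.map fun j => c j ^ i j).prod : C).1 := by
      intro L
      induction L with
      | nil => ext u; simp
      | cons j L ih =>
        rw [List.map_cons, List.prod_cons, List.map_cons, List.prod_cons, mul_comm,
          LinearMap.mulRight_mul, ih]
        have : LinearMap.mulRight ℂ (((f j)⁻¹ ^ i j : Aˣ) : A) = (c j ^ i j : C).1 := by
          rw [Units.val_pow_eq_pow_val, ← LinearMap.pow_mulRight]; rfl
        rw [this]; rfl
    have h3 := congrArg (fun φ : Module.End ℂ A =>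
      φ ((List.ofFn fun j => adEnd (f j : A) ^ i j).prod u)) (h2 (List.finRange l))
    simp only [LinearMap.mulRight_apply, ← List.ofFn_eq_map] at h3
    have h1' := h1 (List.finRange l)
    simp only [← List.ofFn_eq_map] at h1'
    rw [h3, h1', List.prod_ofFn, List.prod_ofFn, List.prod_ofFn]
    simp only [mul_pow, Finset.prod_mul_distrib]
    rw [mul_comm]
    rfl

theorem exists_poly_choose (k : ℕ) :
    ∃ p : Polynomial ℂ, ∀ x : ℂ, Ring.choose x k = p.eval x := by
  refine ⟨Polynomial.C ((k.factorial : ℂ)⁻¹) * (descPochhammer ℤ k).map (algebraMap ℤ ℂ),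
    fun x => ?_⟩
  rw [Ring.choose_eq_smul, Polynomial.eval_mul, Polynomial.eval_C,
    Polynomial.eval_map_algebraMap, Polynomial.aeval_eq_smeval, smul_eq_mul]

theorem exists_mvPoly_choose {l : ℕ} (i : Fin l → ℕ) :
    ∃ p : MvPolynomial (Fin l) ℂ, ∀ x : Fin l → ℂ,
      ∏ j, Ring.choose (x j) (i j) = MvPolynomial.aeval x p := by
  choose P hP using exists_poly_choose
  refine ⟨∏ j, Polynomial.aeval (MvPolynomial.X j) (P (i j)), fun x => ?_⟩
  rw [map_prod]
  refine Finset.prod_congr rfl fun j _ => ?_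
  rw [hP, ← Polynomial.aeval_algHom_apply, MvPolynomial.aeval_X, Polynomial.coe_aeval_eq_eval]

theorem sum_choose_mul_pow {C : Type*} [CommRing C] [Algebra ℂ C] {l : ℕ} (t : Fin l → C)
    (m : Fin l → ℕ) (M : ℕ) (hM : ∀ j, m j < M) :
    ∑ i ∈ Fintype.piFinset (fun _ : Fin l => Finset.range M),
      (∏ j, Ring.choose (m j : ℂ) (i j)) • ∏ j, t j ^ i j = ∏ j, (1 + t j) ^ m j := by
  have : ∀ j, (1 + t j) ^ m j = ∑ k ∈ Finset.range M, Ring.choose (m j : ℂ) k • t j ^ k := by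
    intro j
    rw [add_comm, add_pow]
    rw [← Finset.sum_subset (Finset.range_mono (hM j))]
    · refine Finset.sum_congr rfl fun k _ => ?_
      rw [Ring.choose_natCast, one_pow, mul_one, Algebra.smul_def, mul_comm]
      simp
    · intro k _ hk
      rw [Ring.choose_natCast, Nat.choose_eq_zero_of_lt (by simpa using hk)]
      simp
  simp only [this]
  rw [Finset.prod_univ_sum]
  refine Finset.sum_congr rfl fun i _ => ?_
  simp only [Algebra.smul_def, map_prod, Finset.prod_mul_distrib]

theorem theta_expansion {l : ℕ} (f : Fin l → Aˣ)
    (hf : ∀ i j, Commute (f i : A) (f j))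
    (hnil : ∀ j (u : A), ∃ N : ℕ, (adEnd (f j : A) ^ N) u = 0) :
    ∃ τ : (Fin l → ℕ) → Module.End ℂ A,
      (∀ u, ∃ N : ℕ, ∀ M, N ≤ M → ∀ x, theta f x u =
        ∑ i ∈ Fintype.piFinset (fun _ : Fin l => Finset.range M),
          (∏ j, Ring.choose (x j) (i j)) • τ i u) ∧
      (∀ m : Fin l → ℕ, ∃ s : Module.End ℂ A, s 1 = 1 ∧ (∀ u v, s (u * v) = s u * s v) ∧
        ∀ u, theta f (fun j => (m j : ℂ)) u = s u) := by
  obtain ⟨C, hC, t, hconj, hnil, hτ⟩ := exists_theta_eq f hf hnil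
  let _ : CommRing C := { (inferInstance : Ring C) with mul_comm := hC }
  have h1 : ∀ u, ∃ N : ℕ, ∀ M, N ≤ M → ∀ x, theta f x u =
        ∑ i ∈ Fintype.piFinset (fun _ : Fin l => Finset.range M),
          (∏ j, Ring.choose (x j) (i j)) • (∏ j, t j ^ i j : C).1 u := by
    intro u
    choose N hN using fun j => hnil j u
    refine ⟨∑ j, N j, fun M hM x => ?_⟩
    unfold theta
    simp only [hτ, List.prod_ofFn]
    refine finsum_eq_sum_of_support_subset _ fun i hi => ?_
    rw [Finset.mem_coe, Fintype.mem_piFinset]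
    by_contra! hcon
    obtain ⟨j, hj⟩ := hcon
    apply hi
    have hle : N j ≤ i j :=
      (Finset.single_le_sum (fun _ _ => Nat.zero_le _) (Finset.mem_univ j)).trans
        (hM.trans (by simpa using hj))
    obtain ⟨q, hq⟩ : t j ^ N j ∣ ∏ j, t j ^ i j :=
      (pow_dvd_pow _ hle).trans (Finset.dvd_prod_of_mem _ (Finset.mem_univ j))
    have : (∏ j, t j ^ i j : C).1 u = 0 := by
      rw [hq, mul_comm]
      change q.1 ((t j ^ N j).1 u) = 0
      rw [hN, map_zero]
    change _ • (∏ j, t j ^ i j : C).1 u = 0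
    rw [this, smul_zero]
  refine ⟨fun i => (∏ j, t j ^ i j : C).1, h1, fun m => ?_⟩
  let Mult : Submonoid C :=
    { carrier := {s | s.1 1 = 1 ∧ ∀ u v, s.1 (u * v) = s.1 u * s.1 v}
      one_mem' := ⟨rfl, fun _ _ => rfl⟩
      mul_mem' := by
        rintro p q ⟨hp, hp'⟩ ⟨hq, hq'⟩
        refine ⟨?_, fun u v => ?_⟩
        · change p.1 (q.1 1) = 1
          rw [hq, hp]
        · change p.1 (q.1 (u * v)) = p.1 (q.1 u) * p.1 (q.1 v)
          rw [hq', hp'] }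
  have hmem : ∏ j, (1 + t j) ^ m j ∈ Mult := by
    refine Submonoid.prod_mem _ fun j _ => Submonoid.pow_mem _ ?_ _
    change (1 + t j).1 1 = 1 ∧ ∀ u v, (1 + t j).1 (u * v) = (1 + t j).1 u * (1 + t j).1 v
    refine ⟨?_, fun u v => ?_⟩
    · rw [hconj]; simp
    · rw [hconj, hconj, hconj]; simp [mul_assoc]
  refine ⟨_, hmem.1, hmem.2, fun u => ?_⟩
  obtain ⟨N, hN⟩ := h1 u
  have hb : ∀ j, m j < max N (∑ j, m j + 1) := fun j =>
    (Nat.lt_succ_of_le (Finset.single_le_sum (fun _ _ => Nat.zero_le _)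
      (Finset.mem_univ j))).trans_le (le_max_right _ _)
  rw [hN _ (le_max_left N (∑ j, m j + 1)), ← sum_choose_mul_pow t m _ hb]
  have : ∀ p : C, p.1 u = (LinearMap.applyₗ u ∘ₗ C.val.toLinearMap) p := fun p => rfl
  simp only [this, map_sum, map_smul]

theorem theta_mul {l : ℕ} (f : Fin l → Aˣ)
    (hf : ∀ i j, Commute (f i : A) (f j))
    (hnil : ∀ j (u : A), ∃ N : ℕ, (adEnd (f j : A) ^ N) u = 0) (x : Fin l → ℂ) (u v : A) :
    theta f x (u * v) = theta f x u * theta f x v := by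
  obtain ⟨τ, h1, h2⟩ := theta_expansion f hf hnil
  obtain ⟨N₁, hN₁⟩ := h1 (u * v)
  obtain ⟨N₂, hN₂⟩ := h1 u
  obtain ⟨N₃, hN₃⟩ := h1 v
  have e₁ := hN₁ _ le_rfl
  have e₂ := hN₂ _ le_rfl
  have e₃ := hN₃ _ le_rfl
  choose p hp using exists_mvPoly_choose (l := l)
  rw [← sub_eq_zero, ← Module.forall_dual_apply_eq_zero_iff ℂ]
  intro φ
  let P : MvPolynomial (Fin l) ℂ :=
    (∑ i ∈ Fintype.piFinset (fun _ : Fin l => Finset.range N₁),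
      p i * MvPolynomial.C (φ (τ i (u * v)))) -
    ∑ i ∈ Fintype.piFinset (fun _ : Fin l => Finset.range N₂),
      ∑ k ∈ Fintype.piFinset (fun _ : Fin l => Finset.range N₃),
        p i * p k * MvPolynomial.C (φ (τ i u * τ k v))
  have hP : ∀ y, φ (theta f y (u * v) - theta f y u * theta f y v) = MvPolynomial.eval y P := by
    intro y
    rw [e₁, e₂, e₃]
    simp only [P, map_sub, map_sum, map_smul, map_mul, Finset.sum_mul_sum, smul_mul_smul_comm, hp,
      MvPolynomial.eval_C, smul_eq_mul, MvPolynomial.aeval_eq_eval]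
  have hP0 : P = 0 := by
    refine MvPolynomial.funext_set (fun _ => Set.range (Nat.cast : ℕ → ℂ))
      (fun _ => Set.infinite_range_of_injective Nat.cast_injective) fun y hy => ?_
    rw [← hP, map_zero]
    choose m hm using fun j => hy j (Set.mem_univ j)
    obtain rfl : (fun j => (m j : ℂ)) = y := funext hm
    obtain ⟨s, -, hs, hs'⟩ := h2 m
    rw [hs', hs', hs', hs, sub_self, map_zero]
  rw [hP, hP0, map_zero]

/-- The generalized conjugation is an algebra endomorphism. -/
noncomputable def thetaHom {l : ℕ} (f : Fin l → Aˣ)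
    (hf : ∀ i j, Commute (f i : A) (f j))
    (hnil : ∀ j (u : A), ∃ N : ℕ, (adEnd (f j : A) ^ N) u = 0) (x : Fin l → ℂ) : A →ₐ[ℂ] A :=
  AlgHom.ofLinearMap
    { toFun := theta f x
      map_add' := fun u v => by
        obtain ⟨τ, h1, -⟩ := theta_expansion f hf hnil
        obtain ⟨N₁, hN₁⟩ := h1 (u + v)
        obtain ⟨N₂, hN₂⟩ := h1 u
        obtain ⟨N₃, hN₃⟩ := h1 v
        rw [hN₁ (N₁ + N₂ + N₃) (by omega), hN₂ (N₁ + N₂ + N₃) (by omega),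
          hN₃ (N₁ + N₂ + N₃) (by omega), ← Finset.sum_add_distrib]
        simp only [map_add, smul_add]
      map_smul' := fun c u => by
        obtain ⟨τ, h1, -⟩ := theta_expansion f hf hnil
        obtain ⟨N₁, hN₁⟩ := h1 (c • u)
        obtain ⟨N₂, hN₂⟩ := h1 u
        rw [hN₁ (N₁ + N₂) (by omega), hN₂ (N₁ + N₂) (by omega), RingHom.id_apply,
          Finset.smul_sum]
        simp only [map_smul, smul_comm c] }
    (by
      change theta f x 1 = 1
      have h0 : ∀ i : Fin l → ℕ, i ≠ 0 →
          (List.ofFn fun j => adEnd (f j : A) ^ i j).prod (1 : A) = 0 := by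
        intro i hi
        have key : ∀ L : List (Fin l), (L.map fun j => adEnd (f j : A) ^ i j).prod (1 : A) = 0 ∨
            ((L.map fun j => adEnd (f j : A) ^ i j).prod (1 : A) = 1 ∧ ∀ j ∈ L, i j = 0) := by
          intro L
          induction L with
          | nil => right; simp
          | cons j L ih =>
            rw [List.map_cons, List.prod_cons, Module.End.mul_apply]
            rcases ih with h | ⟨h, h'⟩
            · left; rw [h, map_zero]
            · rw [h]
              rcases hij : i j with _ | k
              · right; simpa [hij] using h'
              · left; rw [pow_succ, Module.End.mul_apply]; simp
        rw [List.ofFn_eq_map]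
        rcases key (List.finRange l) with h | ⟨-, h⟩
        · exact h
        · exact absurd (funext fun j => h j (List.mem_finRange j)) hi
      unfold theta
      rw [finsum_eq_single _ 0]
      · simp
      · intro i hi
        simp [h0 i hi])
    (theta_mul f hf hnil x)

end Generalities

section Localization

variable {g : Type*} [LieRing g] [LieAlgebra ℂ g]

/-- The universal enveloping algebra. A `𝔤`-module is a module over `U 𝔤`. -/
abbrev U (g : Type*) [LieRing g] [LieAlgebra ℂ g] := UniversalEnvelopingAlgebra ℂ g

/-- The canonical map from `𝔤` to its universal enveloping algebra. -/
noncomputable abbrev toU (x : g) : U g := UniversalEnvelopingAlgebra.ι ℂ x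

theorem toU_lie (x y : g) : toU ⁅x, y⁆ = toU x * toU y - toU y * toU x := by
  unfold toU
  rw [LieHom.map_lie, LieRing.of_associative_ring_bracket]

theorem mem_subalgebra_of_toU_mem (S : Subalgebra ℂ (U g)) (hS : ∀ x : g, toU x ∈ S) (u : U g) :
    u ∈ S := by
  let φ : g →ₗ⁅ℂ⁆ S :=
    { toFun := fun x => ⟨toU x, hS x⟩
      map_add' := fun x y => Subtype.ext (map_add (UniversalEnvelopingAlgebra.ι ℂ) x y)
      map_smul' := fun c x => Subtype.ext (map_smul (UniversalEnvelopingAlgebra.ι ℂ) c x)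
      map_lie' := fun {x y} => Subtype.ext (toU_lie x y) }
  have h : S.val.comp (UniversalEnvelopingAlgebra.lift ℂ φ) = AlgHom.id ℂ (U g) := by
    apply UniversalEnvelopingAlgebra.hom_ext
    ext x
    change ((UniversalEnvelopingAlgebra.lift ℂ φ (UniversalEnvelopingAlgebra.ι ℂ x) : S) : U g) = _
    rw [UniversalEnvelopingAlgebra.lift_ι_apply]
    rfl
  have h2 := congrArg (fun ψ : U g →ₐ[ℂ] U g => ψ u) h
  change ((UniversalEnvelopingAlgebra.lift ℂ φ u : S) : U g) = u at h2
  rw [← h2]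
  exact SetLike.coe_mem _

theorem exists_adEnd_pow_toU_eq_zero (x : g) (hx : IsNilpotent (LieAlgebra.ad ℂ g x)) (u : U g) :
    ∃ N : ℕ, (adEnd (toU x) ^ N) u = 0 := by
  refine mem_subalgebra_of_toU_mem (adNilpotent (toU x)) (fun y => ?_) u
  have key : ∀ N : ℕ, (adEnd (toU x) ^ N) (toU y) = toU ((LieAlgebra.ad ℂ g x ^ N) y) := by
    intro N
    induction N with
    | zero => rfl
    | succ N ih =>
      rw [pow_succ', pow_succ', Module.End.mul_apply, Module.End.mul_apply, ih, adEnd_apply,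
        LieAlgebra.ad_apply, toU_lie]
  obtain ⟨N, hN⟩ := hx
  exact ⟨N, by rw [key, hN]; exact map_zero (UniversalEnvelopingAlgebra.ι ℂ)⟩

variable {H : LieSubalgebra ℂ g} [H.IsCartanSubalgebra] {l : ℕ}

/-- The multiplicative subset `F_Γ` of `U(𝔤)` generated by the `f_γ`, `γ ∈ Γ`. -/
def multSet (T : StandardTriples H) (Γ : CommutingRoots H l) : Submonoid (U g) :=
  Submonoid.closure (Set.range fun j => toU (T.f (Γ.root j)))

variable [IsSpOrSl g]

/-- `F_Γ` satisfies the (left) Ore condition. -/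
noncomputable instance oreSet (T : StandardTriples H) (Γ : CommutingRoots H l) :
    OreLocalization.OreSet (multSet T Γ) :=
  Classical.choice <| nonempty_oreSet_closure _ <| by
    rintro _ ⟨j, rfl⟩ u
    exact exists_adEnd_pow_toU_eq_zero _ (isNilpotent_ad_f T Γ j) u

/-- The localization `U_{F_Γ}` of `U(𝔤)` relative to `F_Γ`. -/
abbrev UF (T : StandardTriples H) (Γ : CommutingRoots H l) :=
  OreLocalization (multSet T Γ) (U g)

/-- The element `f_γ`, as a unit of `U_{F_Γ}`. -/
noncomputable def fUnit (T : StandardTriples H) (Γ : CommutingRoots H l) (j : Fin l) :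
    (UF T Γ)ˣ :=
  OreLocalization.numeratorUnit
    (⟨toU (T.f (Γ.root j)), Submonoid.subset_closure ⟨j, rfl⟩⟩ : multSet T Γ)

theorem coe_fUnit (T : StandardTriples H) (Γ : CommutingRoots H l) (j : Fin l) :
    (fUnit T Γ j : UF T Γ) = OreLocalization.numeratorRingHom (toU (T.f (Γ.root j))) := rfl

theorem commute_toU_f (T : StandardTriples H) (Γ : CommutingRoots H l) (i j : Fin l) :
    Commute (toU (T.f (Γ.root i))) (toU (T.f (Γ.root j))) := by
  have h := toU_lie (T.f (Γ.root i)) (T.f (Γ.root j))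
  rw [lie_f_f] at h
  exact (sub_eq_zero.mp (h.symm.trans (map_zero (UniversalEnvelopingAlgebra.ι ℂ))))

theorem commute_fUnit (T : StandardTriples H) (Γ : CommutingRoots H l) (i j : Fin l) :
    Commute (fUnit T Γ i : UF T Γ) (fUnit T Γ j) := by
  rw [coe_fUnit, coe_fUnit]
  exact (commute_toU_f T Γ i j).map _

theorem commute_fUnit_mem (T : StandardTriples H) (Γ : CommutingRoots H l) (j : Fin l)
    (s : U g) (hs : s ∈ multSet T Γ) : Commute (toU (T.f (Γ.root j))) s := by
  induction hs using Submonoid.closure_induction with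
  | mem a ha => obtain ⟨i, rfl⟩ := ha; exact commute_toU_f T Γ j i
  | one => exact Commute.one_right _
  | mul x y _ _ hx hy => exact hx.mul_right hy

theorem exists_adEnd_fUnit_pow_eq_zero (T : StandardTriples H) (Γ : CommutingRoots H l)
    (j : Fin l) (u : UF T Γ) : ∃ N : ℕ, (adEnd (fUnit T Γ j : UF T Γ) ^ N) u = 0 := by
  induction u using OreLocalization.ind with | _ r s
  obtain ⟨N, hN⟩ := exists_adEnd_pow_toU_eq_zero _ (isNilpotent_ad_f T Γ j) r
  refine ⟨N, ?_⟩
  let q : U g →+* UF T Γ := OreLocalization.numeratorRingHom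
  let w : (UF T Γ)ˣ := OreLocalization.numeratorUnit s
  have hc : Commute (fUnit T Γ j : UF T Γ) (w⁻¹ : (UF T Γ)ˣ) := by
    apply Commute.units_inv_right
    exact (commute_fUnit_mem T Γ j s s.2).map q
  have hrs : (r /ₒ s : UF T Γ) = (w⁻¹ : (UF T Γ)ˣ) * q r := by
    change (r /ₒ s : UF T Γ) = (1 /ₒ s) * (r /ₒ 1)
    rw [OreLocalization.one_div_mul, one_mul]
  have key : ∀ n : ℕ, (adEnd (fUnit T Γ j : UF T Γ) ^ n) (r /ₒ s) =
      (w⁻¹ : (UF T Γ)ˣ) * q ((adEnd (toU (T.f (Γ.root j))) ^ n) r) := by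
    intro n
    induction n with
    | zero => exact hrs
    | succ n ih =>
      rw [pow_succ', pow_succ', Module.End.mul_apply, Module.End.mul_apply, ih, adEnd_apply,
        adEnd_apply, ← mul_assoc, hc.eq, map_sub, map_mul, map_mul, coe_fUnit, mul_sub]
      simp only [mul_assoc]
      rfl
  rw [key, hN, map_zero, mul_zero]

/-- The generalized conjugation `Θ_{(x_1,…,x_l)}` of `U_{F_Γ}`; by definition
`Θ_x(u) = ∑_i (∏_j (x_j choose i_j)) ad(f_{γ_1})^{i_1} ⋯ ad(f_{γ_l})^{i_l}(u) ·
f_{γ_1}^{-i_1} ⋯ f_{γ_l}^{-i_l}`. -/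
noncomputable def Theta (T : StandardTriples H) (Γ : CommutingRoots H l) (x : Fin l → ℂ) :
    UF T Γ →ₐ[ℂ] UF T Γ :=
  thetaHom (fUnit T Γ) (commute_fUnit T Γ) (exists_adEnd_fUnit_pow_eq_zero T Γ) x

theorem Theta_apply (T : StandardTriples H) (Γ : CommutingRoots H l) (x : Fin l → ℂ)
    (u : UF T Γ) : Theta T Γ x u = ∑ᶠ i : Fin l → ℕ, (∏ j, Ring.choose (x j) (i j)) •
      ((List.ofFn fun j => adEnd (fUnit T Γ j : UF T Γ) ^ i j).prod u *
        (List.ofFn fun j => (((fUnit T Γ j)⁻¹ ^ i j : (UF T Γ)ˣ) : UF T Γ)).prod) := rfl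

/-- `Φ_Γ^μ N` for `μ = x_1 γ_1 + ⋯ + x_l γ_l`: the space `N` on which `u ∈ U_{F_Γ}` acts as
`Θ_x(u)` does on the `U_{F_Γ}`-module `N`. -/
@[nolint unusedArguments]
def Twist (_T : StandardTriples H) (_Γ : CommutingRoots H l) (_x : Fin l → ℂ) (N : Type*) :
    Type _ := N

section Twist

variable (T : StandardTriples H) (Γ : CommutingRoots H l) (x : Fin l → ℂ) (N : Type*)
  [AddCommGroup N] [Module ℂ N] [Module (UF T Γ) N] [IsScalarTower ℂ (UF T Γ) N]

instance : AddCommGroup (Twist T Γ x N) := inferInstanceAs (AddCommGroup N)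

instance : Module ℂ (Twist T Γ x N) := inferInstanceAs (Module ℂ N)

noncomputable instance : Module (UF T Γ) (Twist T Γ x N) :=
  Module.compHom N (Theta T Γ x).toRingHom

/-- Every `U_{F_Γ}`-module `Φ_Γ^μ N` is a `𝔤`-module by restriction along `U(𝔤) → U_{F_Γ}`. -/
noncomputable instance : Module (U g) (Twist T Γ x N) :=
  Module.compHom (Twist T Γ x N)
    (OreLocalization.numeratorRingHom : U g →+* UF T Γ)

instance : IsScalarTower ℂ (U g) (Twist T Γ x N) where
  smul_assoc c u v := by
    change Theta T Γ x (OreLocalization.numeratorRingHom (c • u)) • (show N from v) =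
      c • (Theta T Γ x (OreLocalization.numeratorRingHom u) • (show N from v))
    have : (OreLocalization.numeratorRingHom (c • u) : UF T Γ) =
        c • OreLocalization.numeratorRingHom u := by
      rw [Algebra.smul_def, map_mul, Algebra.smul_def]; rfl
    rw [this, map_smul, smul_assoc]

end Twist

/-- The `Γ`-localization `𝒟_Γ M = U_{F_Γ} ⊗_U M` of a `𝔤`-module `M`, realised as the module of left
fractions `s⁻¹ m` with `s ∈ F_Γ`, `m ∈ M`. It is a `U_{F_Γ}`-module, and a `𝔤`-module by restriction
along `U(𝔤) → U_{F_Γ}`. -/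
abbrev Loc (T : StandardTriples H) (Γ : CommutingRoots H l) (M : Type*) [AddCommGroup M]
    [Module (U g) M] :=
  OreLocalization (multSet T Γ) M

theorem smul_loc_eq (T : StandardTriples H) (Γ : CommutingRoots H l) (M : Type*) [AddCommGroup M]
    [Module (U g) M] (u : U g) (m : Loc T Γ M) :
    u • m = (OreLocalization.numeratorRingHom u : UF T Γ) • m := by
  rw [← OreLocalization.smul_one_oreDiv_one_smul, smul_eq_mul, mul_one]
  rfl

/-- The twisted localization `𝒟_Γ^μ M = Φ_Γ^μ 𝒟_Γ M`, where `μ = x_1 γ_1 + ⋯ + x_l γ_l`. -/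
abbrev TwLoc (T : StandardTriples H) (Γ : CommutingRoots H l) (x : Fin l → ℂ) (M : Type*)
    [AddCommGroup M] [Module (U g) M] :=
  Twist T Γ x (Loc T Γ M)

end Localization

section Modules

variable {g : Type*} [LieRing g] [LieAlgebra ℂ g] (H : LieSubalgebra ℂ g) [H.IsCartanSubalgebra]
  {l : ℕ} (M : Type*) [AddCommGroup M] [Module ℂ M] [Module (U g) M] [IsScalarTower ℂ (U g) M]

/-- The weight space `M^μ`. -/
def weightSpace (μ : Module.Dual ℂ H) : Submodule ℂ M where
  carrier := {m | ∀ h : H, toU (h : g) • m = μ h • m}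
  add_mem' := fun ha hb h => by rw [smul_add, smul_add, ha h, hb h]
  zero_mem' := fun h => by rw [smul_zero, smul_zero]
  smul_mem' := fun c m hm h => by rw [smul_comm, hm h, smul_comm]

/-- The support of `M`: the set of its weights. -/
def supp : Set (Module.Dual ℂ H) := {μ | weightSpace H M μ ≠ ⊥}

open Classical in
/-- The objects of `ℬ^χ`: weight modules with uniformly bounded weight multiplicities on which
`z - χ(z)` acts locally nilpotently for every `z` in the center of `U(𝔤)`. -/
structure IsBoundedWithCharacter (χ : Subalgebra.center ℂ (U g) →ₐ[ℂ] ℂ) : Prop where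
  isInternal : DirectSum.IsInternal (weightSpace H M)
  exists_bound : ∃ C : ℕ, ∀ μ, Module.rank ℂ (weightSpace H M μ) < C
  exists_pow_smul_eq_zero : ∀ (m : M) (z : Subalgebra.center ℂ (U g)),
    ∃ N : ℕ, ((z : U g) - algebraMap ℂ (U g) (χ z)) ^ N • m = 0

/-- The objects of `ℬ`, the union of the `ℬ^χ`: bounded modules. -/
def IsBoundedModule : Prop :=
  ∃ χ : Subalgebra.center ℂ (U g) →ₐ[ℂ] ℂ, IsBoundedWithCharacter H M χ

variable {H}

/-- `f_γ` acts injectively on `M` for every `γ ∈ Γ`. -/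
def IsGammaInjective (T : StandardTriples H) (Γ : CommutingRoots H l) (M : Type*) [AddCommGroup M]
    [Module (U g) M] : Prop :=
  ∀ j, Function.Injective fun m : M => toU (T.f (Γ.root j)) • m

/-- `f_γ` acts bijectively on `M` for every `γ ∈ Γ`. -/
def IsGammaBijective (T : StandardTriples H) (Γ : CommutingRoots H l) (M : Type*) [AddCommGroup M]
    [Module (U g) M] : Prop :=
  ∀ j, Function.Bijective fun m : M => toU (T.f (Γ.root j)) • m

/-- `Span_ℤ Γ`. -/
def intSpan (Γ : CommutingRoots H l) : Submodule ℤ (Module.Dual ℂ H) :=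
  Submodule.span ℤ (Set.range Γ.root)

/-- A nonzero module that is not the direct sum of two nonzero submodules. -/
def IsIndecomposable (R M : Type*) [Ring R] [AddCommGroup M] [Module R M] : Prop :=
  Nontrivial M ∧ ∀ N₁ N₂ : Submodule R M, IsCompl N₁ N₂ → N₁ = ⊥ ∨ N₂ = ⊥

end Modules

end TwistedLoc

/-! Parts (i) and (ii) rest on `f_γ` becoming a unit of weight `-γ` in `U_{F_Γ}`. It therefore acts
bijectively on `𝒟_Γ M`, and if `M` is already `Γ`-bijective, every fraction comes from `M`.
Monomials in the `f_γ^{±1}` identify the weight spaces of `𝒟_Γ M` along a coset of `Span_ℤ Γ`.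
Finitely many vectors of one weight have a common denominator in `F_Γ`, which carries them
injectively into a single weight space of `M`. Since `M` embeds in `𝒟_Γ M`, the common dimension is
the largest one occurring in `M` (`finrank_weightSpace_loc`). The twist sends `h ∈ 𝔥` to `h + μ(h)`,
so it only translates weights by `μ` (`Theta_toUF_cartan`).

For (iii), a direct summand of `𝒟_Γ^μ M` over `U(𝔤)` is automatically stable under the inverses of
`F_Γ`. As `Θ_x` is surjective, it is then stable under the untwisted action of `U_{F_Γ}`
(`smul_mem_of_isCompl`). After clearing denominators, two nonzero complementary summands meet `M` in
nonzero submodules with zero intersection. This contradicts uniqueness of the simple submodule once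
every nonzero submodule of `M` is known to contain a simple one (`exists_isSimpleModule_le`).

That last fact follows from an Artinian property (`isArtinian_of_bounded`). In a strictly descending
chain, every layer contains a nonzero submodule on which each root vector acts injectively or
locally nilpotently. Let `I` be the set of injective roots. By `𝔰𝔩₂`-theory, the roots outside the
saturated span of `I` act integrably and are orthogonal to `I`, and some weight takes only the
values `-1, 0, 1` on their coroots. Finitely many choices of `I` and of these values, together with
a finite index argument, yield infinitely many layers with the same `I` and with weights in one
coset of `ℤI`. Their supports are stable under adding roots of `I`, so any `C + 1` of them share a
weight `κ`. The chain then drops `C + 1` times inside the weight space of `κ`, whose dimension is at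
most `C`. -/

namespace TwistedLoc

attribute [local instance] LieRing.ofAssociativeRing

/-! ### Singular vectors for an `𝔰𝔩₂`-triple. -/

section SlTwo

variable {A : Type*} [Ring A] {Q : Type*} [AddCommGroup Q] [Module A Q]

theorem exists_pow_smul_ne_zero_and_succ {a : A} {v : Q} (hv : v ≠ 0)
    (hnil : ∃ k : ℕ, a ^ k • v = 0) : ∃ j : ℕ, a ^ j • v ≠ 0 ∧ a ^ (j + 1) • v = 0 := by
  classical
  have hpos : Nat.find hnil ≠ 0 := fun h0 => hv (by
    have := Nat.find_spec hnil
    rwa [h0, pow_zero, one_smul] at this)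
  obtain ⟨j, hj⟩ := Nat.exists_eq_succ_of_ne_zero hpos
  refine ⟨j, Nat.find_min hnil (by omega), ?_⟩
  have := Nat.find_spec hnil
  rwa [hj] at this

theorem pow_smul_eq_zero_of_le {a : A} {v : Q} {i j : ℕ} (hij : i ≤ j) (h : a ^ i • v = 0) :
    a ^ j • v = 0 := by
  obtain ⟨k, rfl⟩ := Nat.exists_eq_add_of_le' hij
  rw [pow_add, mul_smul, h, smul_zero]

variable [Algebra ℂ A] [Module ℂ Q] [IsScalarTower ℂ A Q] {e f h : A}

theorem smul_pow_smul_of_lowering (hhf : h * f - f * h = -(2 • f)) {n : ℂ} {w : Q}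
    (hw : h • w = n • w) (k : ℕ) : h • f ^ k • w = (n - 2 * k) • f ^ k • w := by
  induction k with
  | zero => simpa using hw
  | succ k ih =>
    have h1 : h * f = f * h - (2 : ℂ) • f := by
      rw [sub_eq_iff_eq_add.mp hhf, two_smul, two_smul]; abel
    rw [pow_succ', mul_smul, ← mul_smul h, h1, sub_smul, mul_smul, ih, smul_comm f, smul_assoc,
      ← sub_smul]
    push_cast; ring_nf

theorem raise_pow_succ_smul (hef : e * f - f * e = h) (hhf : h * f - f * h = -(2 • f)) {n : ℂ}
    {w : Q} (he : e • w = 0) (hw : h • w = n • w) (k : ℕ) :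
    e • f ^ (k + 1) • w = ((k + 1) * (n - k)) • f ^ k • w := by
  have h1 : e * f = f * e + h := by rw [← hef]; abel
  induction k with
  | zero => simp [← mul_smul, h1, add_smul, hw, mul_smul f e, he]
  | succ k ih =>
    rw [pow_succ' f (k + 1), mul_smul, ← mul_smul e, h1, add_smul, mul_smul, ih,
      smul_pow_smul_of_lowering hhf hw, smul_comm f, ← mul_smul f, ← pow_succ', ← add_smul]
    push_cast; ring_nf

/-- Iterates the one-step formula. What matters later is when the product is nonzero: lowering a
singular vector then loses no information. -/
theorem raise_pow_lower_pow_smul (hef : e * f - f * e = h) (hhf : h * f - f * h = -(2 • f)) {n : ℂ}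
    {w : Q} (he : e • w = 0) (hw : h • w = n • w) (k : ℕ) :
    e ^ k • f ^ k • w = (∏ s ∈ Finset.range k, ((s + 1) * (n - s))) • w := by
  induction k with
  | zero => simp
  | succ k ih =>
    rw [pow_succ e, mul_smul, raise_pow_succ_smul hef hhf he hw, smul_comm, ih, smul_smul,
      Finset.prod_range_succ, mul_comm]

end SlTwo

/-! ### Weight strings along one root. -/

section Weights

variable {g : Type*} [LieRing g] [LieAlgebra ℂ g] {H : LieSubalgebra ℂ g}
  {Q : Type*} [AddCommGroup Q] [Module ℂ Q] [Module (U g) Q] [IsScalarTower ℂ (U g) Q]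

theorem mem_weightSpace {ν : Module.Dual ℂ H} {v : Q} :
    v ∈ weightSpace H Q ν ↔ ∀ h : H, toU (h : g) • v = ν h • v := Iff.rfl

theorem mem_supp_iff {ν : Module.Dual ℂ H} :
    ν ∈ supp H Q ↔ ∃ v ∈ weightSpace H Q ν, v ≠ 0 :=
  Submodule.ne_bot_iff _

theorem toU_smul_mem_weightSpace {α ν : Module.Dual ℂ H} {x : g}
    (hx : ∀ h : H, ⁅(h : g), x⁆ = α h • x) {v : Q} (hv : v ∈ weightSpace H Q ν) :
    toU x • v ∈ weightSpace H Q (ν + α) := by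
  intro h
  have h1 : toU (h : g) * toU x = toU x * toU (h : g) + α h • toU x := by
    rw [← sub_eq_iff_eq_add', ← toU_lie, hx]
    exact map_smul (UniversalEnvelopingAlgebra.ι ℂ) _ _
  rw [← mul_smul, h1, add_smul, mul_smul, hv h, smul_comm, smul_assoc, ← add_smul,
    LinearMap.add_apply]

theorem toU_pow_smul_mem_weightSpace {α ν : Module.Dual ℂ H} {x : g}
    (hx : ∀ h : H, ⁅(h : g), x⁆ = α h • x) {v : Q} (hv : v ∈ weightSpace H Q ν) (k : ℕ) :
    toU x ^ k • v ∈ weightSpace H Q (ν + k • α) := by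
  induction k with
  | zero => simpa using hv
  | succ k ih =>
    rw [pow_succ', mul_smul, succ_nsmul, ← add_assoc]
    exact toU_smul_mem_weightSpace hx ih

/-- `(hh, e, f)` is a standard triple attached to the weight `α`. -/
structure IsRootTriple (H : LieSubalgebra ℂ g) (α : Module.Dual ℂ H) (hh : H) (e f : g) :
    Prop where
  isSl2Triple : IsSl2Triple (hh : g) e f
  lie_e : ∀ h : H, ⁅(h : g), e⁆ = α h • e
  lie_f : ∀ h : H, ⁅(h : g), f⁆ = (-α) h • f

namespace IsRootTriple

variable {α ν : Module.Dual ℂ H} {hh : H} {e f : g}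

theorem symm (t : IsRootTriple H α hh e f) : IsRootTriple H (-α) (-hh) f e where
  isSl2Triple := by simpa using t.isSl2Triple.symm
  lie_e := t.lie_f
  lie_f := by simpa using t.lie_e

theorem apply_self (t : IsRootTriple H α hh e f) : α hh = 2 := by
  have h1 := t.isSl2Triple.lie_h_e_nsmul
  rw [t.lie_e, ← Nat.cast_smul_eq_nsmul ℂ] at h1
  have h2 : e ≠ 0 := by
    intro h0
    apply t.isSl2Triple.h_ne_zero
    rw [← t.isSl2Triple.lie_e_f, h0, zero_lie]
  simpa using smul_left_injective ℂ h2 h1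

theorem toU_e_f (t : IsRootTriple H α hh e f) :
    toU e * toU f - toU f * toU e = toU (hh : g) := by
  rw [← toU_lie, t.isSl2Triple.lie_e_f]

theorem toU_h_f (t : IsRootTriple H α hh e f) :
    toU (hh : g) * toU f - toU f * toU (hh : g) = -(2 • toU f) := by
  rw [← toU_lie, t.isSl2Triple.lie_h_f_nsmul, toU, map_neg, map_nsmul]

/-- If `e_α` acts locally nilpotently and the weight spaces are finite dimensional, then
`α`-strings of weights are bounded above. -/
theorem not_forall_add_nsmul_mem_supp (t : IsRootTriple H α hh e f)
    (hfd : ∀ ν, FiniteDimensional ℂ (weightSpace H Q ν))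
    (hnil : ∀ v : Q, ∃ k : ℕ, toU e ^ k • v = 0) (ν : Module.Dual ℂ H) :
    ¬ ∀ k : ℕ, ν + k • α ∈ supp H Q := by
  intro hsupp
  -- If `ν(h) = -(s+1)`, moving up by `(s+1)α` changes this value to `s+1`, and then no equation of
  -- this kind can hold.
  wlog hν : ∀ s : ℕ, ν hh + s + 1 ≠ 0 generalizing ν
  · push Not at hν
    obtain ⟨s, hs⟩ := hν
    refine this (ν + (s + 1) • α) (fun k => ?_) fun r hr => ?_
    · rw [add_assoc, ← add_smul]; exact hsupp _
    · have : ((s + 1 + r + 1 : ℕ) : ℂ) = 0 := by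
        simp only [LinearMap.add_apply, LinearMap.smul_apply, t.apply_self] at hr
        push_cast
        simp only [nsmul_eq_mul] at hr
        push_cast at hr
        linear_combination hr - hs
      exact absurd (Nat.cast_eq_zero.mp this) (by omega)
  -- Raise a vector of weight `ν + kα` until it is singular, then lower it back to weight `ν`.
  -- Raising undoes the lowering up to a scalar, nonzero by the choice of `ν`, so arbitrarily large
  -- nilpotency orders of `e` occur in one weight space.
  have hsing : ∀ k : ℕ, ∃ m, k ≤ m ∧ ∃ u ∈ weightSpace H Q ν,
      toU e ^ m • u ≠ 0 ∧ toU e ^ (m + 1) • u = 0 := by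
    intro k
    obtain ⟨v, hv, hv0⟩ := mem_supp_iff.mp (hsupp k)
    obtain ⟨j, hj, hj'⟩ := exists_pow_smul_ne_zero_and_succ hv0 (hnil v)
    have hw := toU_pow_smul_mem_weightSpace t.lie_e hv j
    rw [add_assoc, ← add_smul] at hw
    have hew : toU e • toU e ^ j • v = 0 := by rwa [← mul_smul, ← pow_succ']
    have key := raise_pow_lower_pow_smul t.toU_e_f t.toU_h_f hew (hw hh) (k + j)
    refine ⟨k + j, by omega, toU f ^ (k + j) • toU e ^ j • v, ?_, ?_, ?_⟩
    · have := toU_pow_smul_mem_weightSpace t.lie_f hw (k + j)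
      simpa using this
    · rw [key]
      refine smul_ne_zero (Finset.prod_ne_zero_iff.mpr fun s hs => mul_ne_zero ?_ ?_) hj
      · exact_mod_cast Nat.succ_ne_zero s
      · rw [Finset.mem_range] at hs
        obtain ⟨r, hr⟩ : ∃ r, 2 * (k + j) = s + (r + 1) := ⟨2 * (k + j) - s - 1, by omega⟩
        have hr' : (2 * (k + j) : ℂ) = s + (r + 1) := by exact_mod_cast hr
        have := hν r
        intro h0
        apply this
        simp only [LinearMap.add_apply, LinearMap.smul_apply, t.apply_self, nsmul_eq_mul] at h0
        push_cast at h0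
        linear_combination h0 - hr'
    · rw [pow_succ', mul_smul, key, smul_comm, hew, smul_zero]
  let E : Module.End ℂ Q := Algebra.lsmul ℂ ℂ Q (toU e)
  have hE : ∀ k v, (E ^ k) v = toU e ^ k • v := fun k v => by
    rw [← map_pow]; rfl
  -- The kernels of the powers of `e` on a finite-dimensional weight space stabilise, which bounds
  -- these orders.
  let F : ℕ →o Submodule ℂ (weightSpace H Q ν) :=
    { toFun := fun k => (LinearMap.ker (E ^ k)).comap (weightSpace H Q ν).subtype
      monotone' := fun i j hij v hv => by
        simp only [Submodule.mem_comap, LinearMap.mem_ker, hE] at hv ⊢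
        exact pow_smul_eq_zero_of_le hij hv }
  obtain ⟨n, hn⟩ := monotone_stabilizes_iff_noetherian.mpr
    (inferInstance : IsNoetherian ℂ (weightSpace H Q ν)) F
  obtain ⟨m, hm, u, hu, h1, h2⟩ := hsing n
  have h3 : (⟨u, hu⟩ : weightSpace H Q ν) ∈ F (m + 1) := by
    change (E ^ (m + 1)) u = 0
    rw [hE, h2]
  rw [← hn (m + 1) (by omega), hn m hm] at h3
  change (E ^ m) u = 0 at h3
  exact h1 (by rwa [hE] at h3)

/-- If `e_α` and `f_α` act locally nilpotently, then weights are integral on `h_α` and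
`α`-strings contain the expected segment. -/
theorem exists_int_of_mem_supp (t : IsRootTriple H α hh e f)
    (he : ∀ v : Q, ∃ k : ℕ, toU e ^ k • v = 0) (hf : ∀ v : Q, ∃ k : ℕ, toU f ^ k • v = 0)
    (hν : ν ∈ supp H Q) :
    ∃ m : ℤ, ν hh = m ∧ ∀ i : ℕ, (i : ℤ) ≤ m → ν - i • α ∈ supp H Q := by
  obtain ⟨v, hv, hv0⟩ := mem_supp_iff.mp hν
  obtain ⟨j, hj, hj'⟩ := exists_pow_smul_ne_zero_and_succ hv0 (he v)
  have hw := toU_pow_smul_mem_weightSpace t.lie_e hv j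
  have hew : toU e • toU e ^ j • v = 0 := by rwa [← mul_smul, ← pow_succ']
  obtain ⟨k, hk, hk'⟩ := exists_pow_smul_ne_zero_and_succ hj (hf _)
  have h1 := raise_pow_succ_smul t.toU_e_f t.toU_h_f hew (hw hh) k
  rw [hk', smul_zero] at h1
  have h2 := (smul_eq_zero.mp h1.symm).resolve_right hk
  have h3 : (k + 1 : ℂ) ≠ 0 := by exact_mod_cast Nat.succ_ne_zero k
  have h4 := (mul_eq_zero.mp h2).resolve_left h3
  simp only [LinearMap.add_apply, LinearMap.smul_apply, t.apply_self, nsmul_eq_mul] at h4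
  -- The singular vector `e^j v` has `h`-eigenvalue `ν(h) + 2j`, which equals the last exponent `k`
  -- with `f^k` nonzero on it. Reaching `ν - iα` takes `i + j` lowerings, and `i ≤ k - 2j` gives `i
  -- + j ≤ k`.
  refine ⟨k - 2 * j, by push_cast; linear_combination h4, fun i hi => ?_⟩
  refine mem_supp_iff.mpr ⟨toU f ^ (i + j) • toU e ^ j • v, ?_, fun h0 => hk ?_⟩
  · have := toU_pow_smul_mem_weightSpace t.lie_f hw (i + j)
    rwa [show ν + j • α + (i + j) • -α = ν - i • α by module] at this
  · exact pow_smul_eq_zero_of_le (by omega) h0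

/-- The string of length `ν(h)` runs along `-α` or along `α` according to the sign of this integer,
whence the use of both the triple and its opposite. -/
theorem reflection_mem_supp (t : IsRootTriple H α hh e f)
    (he : ∀ v : Q, ∃ k : ℕ, toU e ^ k • v = 0) (hf : ∀ v : Q, ∃ k : ℕ, toU f ^ k • v = 0)
    (hν : ν ∈ supp H Q) : ν - ν hh • α ∈ supp H Q := by
  obtain ⟨m, hm, h1⟩ := t.exists_int_of_mem_supp he hf hν
  obtain ⟨m', hm', h2⟩ := t.symm.exists_int_of_mem_supp hf he hν
  obtain rfl : m' = -m := by
    have : (m' : ℂ) = ((-m : ℤ) : ℂ) := by rw [← hm', map_neg, hm]; push_cast; ring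
    exact_mod_cast this
  rw [hm]
  obtain ⟨i, rfl | rfl⟩ := Int.eq_nat_or_neg m
  · simpa [← Nat.cast_smul_eq_nsmul ℂ] using h1 i le_rfl
  · simpa [← Nat.cast_smul_eq_nsmul ℂ] using h2 i (by simp)

end IsRootTriple

end Weights

/-! ### Submodules and quotients of weight modules. -/

section Grading

variable {g : Type*} [LieRing g] [LieAlgebra ℂ g] {H : LieSubalgebra ℂ g}
  {Q : Type*} [AddCommGroup Q] [Module ℂ Q] [Module (U g) Q] [IsScalarTower ℂ (U g) Q]

/-- Submodules are graded: the weight components of an element of a submodule belong to it. -/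
theorem mem_of_sum_weight_mem (B : Submodule (U g) Q) (s : Finset (Module.Dual ℂ H)) :
    ∀ v : Module.Dual ℂ H → Q, (∀ μ ∈ s, v μ ∈ weightSpace H Q μ) → ∑ μ ∈ s, v μ ∈ B →
      ∀ μ ∈ s, v μ ∈ B := by
  classical
  induction s using Finset.induction_on with
  | empty => intro v _ _ μ hμ; simp at hμ
  | insert κ s hκ ih =>
    intro v hv hB
    have h1 : ∀ μ ∈ s, v μ ∈ B := by
      intro μ hμ
      -- The operator `h - κ(h)` kills the `κ`-component and scales the `μ`-component by a nonzero
      -- factor, which reduces the claim to the smaller set.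
      obtain ⟨h, hh⟩ : ∃ h, μ h ≠ κ h := by
        by_contra! hc
        exact hκ (LinearMap.ext hc ▸ hμ)
      have h2 : ∑ ρ ∈ s, (ρ h - κ h) • v ρ ∈ B := by
        have h3 := B.sub_mem (B.smul_mem (toU (h : g)) hB) (B.smul_of_tower_mem (κ h) hB)
        rw [Finset.smul_sum, Finset.smul_sum, ← Finset.sum_sub_distrib,
          Finset.sum_insert hκ, hv κ (Finset.mem_insert_self _ _) h, sub_self, zero_add] at h3
        convert h3 using 1
        refine Finset.sum_congr rfl fun ρ hρ => ?_
        rw [hv ρ (Finset.mem_insert_of_mem hρ) h, sub_smul]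
      have h4 := ih (fun ρ => (ρ h - κ h) • v ρ)
        (fun ρ hρ => Submodule.smul_mem _ _ (hv ρ (Finset.mem_insert_of_mem hρ))) h2 μ hμ
      have h5 := B.smul_of_tower_mem (μ h - κ h)⁻¹ h4
      rwa [smul_smul, inv_mul_cancel₀ (sub_ne_zero.mpr hh), one_smul] at h5
    intro μ hμ
    rcases Finset.mem_insert.mp hμ with rfl | hμ
    · rw [Finset.sum_insert hκ] at hB
      exact (B.add_mem_iff_left (B.sum_mem h1)).mp hB
    · exact h1 μ hμ

theorem exists_sum_weight_eq {p : Module.Dual ℂ H → Prop} {v : Q}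
    (hv : v ∈ ⨆ (μ : Module.Dual ℂ H) (_ : p μ), weightSpace H Q μ) :
    ∃ (s : Finset (Module.Dual ℂ H)) (w : Module.Dual ℂ H → Q),
      (∀ μ ∈ s, p μ) ∧ (∀ μ, w μ ∈ weightSpace H Q μ) ∧ ∑ μ ∈ s, w μ = v := by
  classical
  obtain ⟨w, hw, rfl⟩ := (Submodule.mem_iSup_iff_exists_finsupp _ _).mp hv
  refine ⟨w.support, w, fun μ hμ => ?_, fun μ => ?_, rfl⟩
  · by_contra hp
    have := hw μ
    simp only [hp, iSup_false, Submodule.mem_bot] at this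
    exact Finsupp.mem_support_iff.mp hμ this
  · have := hw μ
    by_cases hp : p μ
    · simpa [hp] using this
    · simp only [hp, iSup_false, Submodule.mem_bot] at this
      rw [this]; exact Submodule.zero_mem _

/-- In a weight module, a vector of weight `ν` modulo a submodule lifts to a vector of
weight `ν`. -/
theorem exists_mem_weightSpace_sub_mem (hQ : ⨆ μ, weightSpace H Q μ = ⊤) (B : Submodule (U g) Q)
    {ν : Module.Dual ℂ H} {v : Q} (hv : ∀ h : H, toU (h : g) • v - ν h • v ∈ B) :
    ∃ w ∈ weightSpace H Q ν, w - v ∈ B := by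
  classical
  obtain ⟨s, w, -, hw, rfl⟩ := exists_sum_weight_eq (H := H) (p := fun _ => True) (v := v)
    (by simp [hQ])
  -- Modulo `B` the operator `h - ν(h)` kills `v`; since `B` is graded, every component of weight
  -- other than `ν` lies in `B`.
  have h1 : ∀ μ ∈ s, μ ≠ ν → w μ ∈ B := by
    intro μ hμ hne
    obtain ⟨h, hh⟩ : ∃ h, μ h ≠ ν h := by
      by_contra! hc
      exact hne (LinearMap.ext hc)
    have h2 := hv h
    rw [Finset.smul_sum, Finset.smul_sum, ← Finset.sum_sub_distrib] at h2
    have h3 : ∑ ρ ∈ s, (ρ h - ν h) • w ρ ∈ B := by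
      convert h2 using 1
      refine Finset.sum_congr rfl fun ρ hρ => ?_
      rw [hw ρ h, sub_smul]
    have h4 := mem_of_sum_weight_mem B s (fun ρ => (ρ h - ν h) • w ρ)
      (fun ρ hρ => Submodule.smul_mem _ _ (hw ρ)) h3 μ hμ
    have h5 := B.smul_of_tower_mem (μ h - ν h)⁻¹ h4
    rwa [smul_smul, inv_mul_cancel₀ (sub_ne_zero.mpr hh), one_smul] at h5
  -- If `ν` does not occur in the decomposition, then `v` itself lies in `B` and `0` is a lift.
  refine ⟨if ν ∈ s then w ν else 0, by split_ifs; exacts [hw ν, Submodule.zero_mem _], ?_⟩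
  rw [← Finset.sum_ite_eq s ν w, ← Finset.sum_sub_distrib]
  refine B.sum_mem fun μ hμ => ?_
  split_ifs with h
  · simp
  · simpa using h1 μ hμ (Ne.symm h)

theorem iSup_weightSpace_quotient (hQ : ⨆ μ, weightSpace H Q μ = ⊤) (B : Submodule (U g) Q) :
    ⨆ μ, weightSpace H (Q ⧸ B) μ = ⊤ := by
  rw [eq_top_iff]
  rintro v -
  obtain ⟨v, rfl⟩ := B.mkQ_surjective v
  obtain ⟨s, w, -, hw, rfl⟩ := exists_sum_weight_eq (H := H) (p := fun _ => True) (v := v)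
    (by simp [hQ])
  rw [map_sum]
  refine Submodule.sum_mem _ fun μ _ => Submodule.mem_iSup_of_mem μ fun h => ?_
  rw [← map_smul, hw μ h]
  rfl

theorem finiteDimensional_weightSpace_quotient (hQ : ⨆ μ, weightSpace H Q μ = ⊤)
    (B : Submodule (U g) Q) {ν : Module.Dual ℂ H} [FiniteDimensional ℂ (weightSpace H Q ν)] :
    FiniteDimensional ℂ (weightSpace H (Q ⧸ B) ν) := by
  let φ : weightSpace H Q ν →ₗ[ℂ] weightSpace H (Q ⧸ B) ν :=
    { toFun := fun v => ⟨B.mkQ v, fun h => by rw [← map_smul, v.2 h]; rfl⟩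
      map_add' := fun v w => rfl
      map_smul' := fun c v => rfl }
  refine Module.Finite.of_surjective φ ?_
  rintro ⟨v, hv⟩
  obtain ⟨v, rfl⟩ := B.mkQ_surjective v
  obtain ⟨w, hw, hwv⟩ := exists_mem_weightSpace_sub_mem hQ B (ν := ν) (v := v) fun h => by
    rw [← Submodule.Quotient.mk_eq_zero, Submodule.Quotient.mk_sub, sub_eq_zero]
    exact hv h
  exact ⟨⟨w, hw⟩, Subtype.ext ((Submodule.Quotient.eq B).mpr hwv)⟩

theorem finiteDimensional_weightSpace_submodule (P : Submodule (U g) Q) {ν : Module.Dual ℂ H}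
    [FiniteDimensional ℂ (weightSpace H Q ν)] : FiniteDimensional ℂ (weightSpace H P ν) := by
  let φ : weightSpace H P ν →ₗ[ℂ] weightSpace H Q ν :=
    { toFun := fun v => ⟨v.1.1, fun h => congrArg Subtype.val (v.2 h)⟩
      map_add' := fun v w => rfl
      map_smul' := fun c v => rfl }
  refine Module.Finite.of_injective φ fun v w h => ?_
  exact Subtype.ext (Subtype.ext (congrArg (fun z : weightSpace H Q ν => (z : Q)) h))

/-- Nonzero submodules of weight modules contain nonzero weight vectors. -/
theorem exists_weight_vector_mem (hQ : ⨆ μ, weightSpace H Q μ = ⊤) {P : Submodule (U g) Q}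
    (hP : P ≠ ⊥) : ∃ ν, ∃ v ∈ weightSpace H Q ν, v ∈ P ∧ v ≠ 0 := by
  obtain ⟨v, hv, hv0⟩ := P.ne_bot_iff.mp hP
  obtain ⟨s, w, -, hw, rfl⟩ := exists_sum_weight_eq (H := H) (p := fun _ => True) (v := v)
    (by simp [hQ])
  obtain ⟨μ, hμ, hμ0⟩ := Finset.exists_ne_zero_of_sum_ne_zero hv0
  exact ⟨μ, w μ, hw μ, mem_of_sum_weight_mem P s w (fun μ _ => hw μ) hv μ hμ, hμ0⟩

theorem supp_submodule_iff (P : Submodule (U g) Q) {ν : Module.Dual ℂ H} :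
    ν ∈ supp H P ↔ ∃ v ∈ weightSpace H Q ν, v ∈ P ∧ v ≠ 0 := by
  rw [mem_supp_iff]
  constructor
  · rintro ⟨v, hv, hv0⟩
    exact ⟨v, fun h => congrArg Subtype.val (hv h), v.2, by simpa using hv0⟩
  · rintro ⟨v, hv, hP, hv0⟩
    exact ⟨⟨v, hP⟩, fun h => Subtype.ext (hv h), by simpa using hv0⟩

theorem iSup_weightSpace_submodule (hQ : ⨆ μ, weightSpace H Q μ = ⊤) (P : Submodule (U g) Q) :
    ⨆ μ, weightSpace H P μ = ⊤ := by
  rw [eq_top_iff]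
  rintro ⟨v, hv⟩ -
  obtain ⟨s, w, -, hw, rfl⟩ := exists_sum_weight_eq (H := H) (p := fun _ => True) (v := v)
    (by simp [hQ])
  have hP := mem_of_sum_weight_mem P s w (fun μ _ => hw μ) hv
  have : (⟨∑ μ ∈ s, w μ, hv⟩ : P) = ∑ μ ∈ s.attach, ⟨w μ, hP μ μ.2⟩ := by
    apply Subtype.ext
    rw [AddSubmonoidClass.coe_finsetSum]
    exact (Finset.sum_attach s w).symm
  rw [this]
  exact Submodule.sum_mem _ fun μ _ =>
    Submodule.mem_iSup_of_mem μ.1 fun h => Subtype.ext (hw μ h)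

end Grading

/-! ### The injective/nilpotent dichotomy for ad-nilpotent elements. -/

section LocallyNilpotent

variable {A : Type*} [Ring A] [Algebra ℂ A] {Q : Type*} [AddCommGroup Q] [Module A Q]

/-- An Ore condition for the powers of `a`; it makes the `a`-power torsion of a module a submodule.
-/
theorem exists_pow_mul_eq_mul_pow {a : A} (ha : ∀ u : A, ∃ N : ℕ, (adEnd a ^ N) u = 0) (k : ℕ)
    (u : A) : ∃ (n : ℕ) (u' : A), a ^ n * u = u' * a ^ k := by
  induction k with
  | zero => exact ⟨0, u, by simp⟩
  | succ k ih =>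
    obtain ⟨n, u', h⟩ := ih
    obtain ⟨N, hN⟩ := ha u'
    obtain ⟨u'', h'⟩ := exists_pow_mul_eq a N u' hN
    exact ⟨N + n, u'', by rw [pow_add, mul_assoc, h, ← mul_assoc, h', mul_assoc, ← pow_succ']⟩

/-- The submodule of vectors killed by a power of an ad-nilpotent element. -/
def powTorsion (Q : Type*) [AddCommGroup Q] [Module A Q] {a : A}
    (ha : ∀ u : A, ∃ N : ℕ, (adEnd a ^ N) u = 0) : Submodule A Q where
  carrier := {v | ∃ k : ℕ, a ^ k • v = 0}
  add_mem' := by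
    rintro v w ⟨m, hm⟩ ⟨n, hn⟩
    exact ⟨m + n, by rw [smul_add, pow_smul_eq_zero_of_le (by omega) hm,
      pow_smul_eq_zero_of_le (by omega) hn, add_zero]⟩
  zero_mem' := ⟨0, smul_zero _⟩
  smul_mem' := by
    rintro u v ⟨k, hk⟩
    obtain ⟨n, u', h⟩ := exists_pow_mul_eq_mul_pow ha k u
    exact ⟨n, by rw [← mul_smul, h, mul_smul, hk, smul_zero]⟩

/-- Every nonzero submodule contains a nonzero submodule on which each of finitely many
ad-nilpotent elements acts either injectively or locally nilpotently. -/
theorem exists_le_injective_or_nilpotent {ι : Type*} [Finite ι] (a : ι → A)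
    (ha : ∀ i u, ∃ N : ℕ, (adEnd (a i) ^ N) u = 0) {P₀ : Submodule A Q} (hP₀ : P₀ ≠ ⊥) :
    ∃ P ≤ P₀, P ≠ ⊥ ∧ ∃ I : Set ι, (∀ i ∈ I, ∀ v ∈ P, a i • v = 0 → v = 0) ∧
      ∀ i ∉ I, ∀ v ∈ P, ∃ k : ℕ, a i ^ k • v = 0 := by
  classical
  have := Fintype.ofFinite ι
  have key : ∀ s : Finset ι, ∃ P ≤ P₀, P ≠ ⊥ ∧ ∀ i ∈ s, (∀ v ∈ P, a i • v = 0 → v = 0) ∨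
      ∀ v ∈ P, ∃ k : ℕ, a i ^ k • v = 0 := by
    intro s
    induction s using Finset.induction_on with
    | empty => exact ⟨P₀, le_rfl, hP₀, by simp⟩
    | insert i s _ ih =>
      obtain ⟨P, hP, hP0, h⟩ := ih
      by_cases hc : ∀ v ∈ P, a i • v = 0 → v = 0
      · refine ⟨P, hP, hP0, fun j hj => ?_⟩
        rcases Finset.mem_insert.mp hj with rfl | hj
        exacts [Or.inl hc, h j hj]
      · push Not at hc
        obtain ⟨v, hv, hv', hv0⟩ := hc
        -- A nonzero vector killed by `a i` keeps the torsion part nonzero, and the alternatives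
        -- already settled for other elements pass to submodules.
        refine ⟨P ⊓ powTorsion Q (ha i), inf_le_left.trans hP, ?_, fun j hj => ?_⟩
        · exact (Submodule.ne_bot_iff _).mpr ⟨v, ⟨hv, 1, by simpa using hv'⟩, hv0⟩
        · rcases Finset.mem_insert.mp hj with rfl | hj
          · exact Or.inr fun v hv => hv.2
          · exact (h j hj).imp (fun h v hv => h v hv.1) (fun h v hv => h v hv.1)
  obtain ⟨P, hP, hP0, h⟩ := key Finset.univ
  refine ⟨P, hP, hP0, {i | ∀ v ∈ P, a i • v = 0 → v = 0}, fun i hi => hi, fun i hi => ?_⟩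
  exact (h i (Finset.mem_univ i)).resolve_left hi

end LocallyNilpotent

/-! ### Root pairings and saturated subgroups. -/

section RootPairings

/-- Invariance of the root form under the reflection in the `j`-th root. -/
theorem rootForm_apply_root {ι R M N : Type*} [Fintype ι] [CommRing R] [AddCommGroup M] [Module R M]
    [AddCommGroup N] [Module R N] (P : RootPairing ι R M N) (x : M) (j : ι) :
    2 * P.RootForm x (P.root j) = P.coroot' j x * P.RootForm (P.root j) (P.root j) := by
  have h := P.rootForm_reflection_reflection_apply j x (P.root j)
  rw [P.reflection_apply_self, P.reflection_apply, map_neg, LinearMap.map_sub₂, LinearMap.map_smul₂,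
    smul_eq_mul] at h
  linear_combination -h

/-- The mixed term of the expanded square is a value of the root form, since the indices outside `F`
contribute nothing to it. The formula shows that subtracting a root on whose coroot `x` exceeds `1`
lowers the sum of squares. -/
theorem sum_coroot_sub_root_sq {ι R M N : Type*} [Fintype ι] [CommRing R] [AddCommGroup M]
    [Module R M] [AddCommGroup N] [Module R N] (P : RootPairing ι R M N) (F : Finset ι) (j : ι)
    (hF : ∀ i ∉ F, P.pairing j i = 0) (x : M) :
    ∑ i ∈ F, P.coroot' i (x - P.root j) ^ 2 =
      ∑ i ∈ F, P.coroot' i x ^ 2 - (P.coroot' j x - 1) * ∑ i ∈ F, P.pairing j i ^ 2 := by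
  have hsub : ∀ c : ι → R, ∑ i ∈ F, c i * P.pairing j i = ∑ i, c i * P.pairing j i := fun c =>
    Finset.sum_subset (Finset.subset_univ F) fun i _ hi => by rw [hF i hi, mul_zero]
  have h1 := rootForm_apply_root P x j
  simp only [RootPairing.rootForm_apply_apply, RootPairing.root_coroot'_eq_pairing] at h1
  rw [← hsub, ← hsub] at h1
  simp only [map_sub, RootPairing.root_coroot'_eq_pairing, sub_sq, Finset.sum_add_distrib,
    Finset.sum_sub_distrib]
  simp only [sq, mul_assoc, ← Finset.mul_sum]
  linear_combination -h1

end RootPairings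

/-- The elements of an abelian group with a nonzero multiple in a given subgroup. -/
def saturation {V : Type*} [AddCommGroup V] (L : Submodule ℤ V) : Submodule ℤ V where
  carrier := {x | ∃ D : ℤ, D ≠ 0 ∧ D • x ∈ L}
  add_mem' := by
    rintro x y ⟨a, ha, hx⟩ ⟨b, hb, hy⟩
    refine ⟨a * b, mul_ne_zero ha hb, ?_⟩
    rw [smul_add]
    refine L.add_mem ?_ ?_
    · rw [mul_comm, mul_smul]; exact L.smul_mem b hx
    · rw [mul_smul]; exact L.smul_mem a hy
  zero_mem' := ⟨1, one_ne_zero, by simp⟩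
  smul_mem' := by
    rintro c x ⟨a, ha, hx⟩
    exact ⟨a, ha, by rw [smul_comm]; exact L.smul_mem c hx⟩

theorem le_saturation {V : Type*} [AddCommGroup V] (L : Submodule ℤ V) : L ≤ saturation L :=
  fun x hx => ⟨1, one_ne_zero, by simpa using hx⟩

open LieAlgebra.IsKilling

/-! ### Root vectors for all roots. -/

section RootVectors

variable {g : Type*} [LieRing g] [LieAlgebra ℂ g] [FiniteDimensional ℂ g] [LieAlgebra.IsKilling ℂ g]

/-- A choice of root vectors for all roots. -/
structure RootVectors (H : LieSubalgebra ℂ g) [H.IsCartanSubalgebra] where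
  e : H.root → g
  f : H.root → g
  triple : ∀ i, IsRootTriple H ((rootSystem H).root i) ((rootSystem H).coroot i) (e i) (f i)
  isNilpotent_ad : ∀ i, IsNilpotent (LieAlgebra.ad ℂ g (e i))
  exists_f_eq : ∀ i j, (rootSystem H).root j = -(rootSystem H).root i → ∃ c : ℂ, f i = c • e j

variable (H : LieSubalgebra ℂ g) [H.IsCartanSubalgebra]

/-- The last field holds because root spaces are one-dimensional: `f i` lies in the line spanned by
the vector chosen for the opposite root. -/
theorem nonempty_rootVectors : Nonempty (RootVectors H) := by
  have key : ∀ i : H.root, ∃ e f : g,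
      IsSl2Triple ((rootSystem H).coroot i : g) e f ∧ e ∈ LieAlgebra.rootSpace H i.1 ∧
      f ∈ LieAlgebra.rootSpace H (-i.1) := by
    intro i
    have hi : i.1.IsNonZero := LieSubalgebra.isNonZero_coe_root i
    obtain ⟨h, e, f, ht, he, hf⟩ := exists_isSl2Triple_of_weight_isNonZero hi
    refine ⟨e, f, ?_, he, hf⟩
    rw [rootSystem_coroot_apply, ← ht.h_eq_coroot hi he hf]
    exact ht
  choose e f ht he hf using key
  refine ⟨⟨e, f, fun i => ⟨ht i, fun h => lie_eq_smul_of_mem_rootSpace (he i) h,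
    fun h => lie_eq_smul_of_mem_rootSpace (hf i) h⟩, fun i => ?_, fun i j hij => ?_⟩⟩
  · exact LieAlgebra.isNilpotent_ad_of_mem_rootSpace H
      (LieSubalgebra.isNonZero_coe_root i) (he i)
  · have hj : j.1 = -i.1 := by
      ext x
      exact LinearMap.congr_fun hij x
    have h1 := finrank_rootSpace_eq_one j.1 (LieSubalgebra.isNonZero_coe_root j)
    have he0 : (⟨e j, he j⟩ : LieAlgebra.rootSpace H j.1) ≠ 0 := by
      intro h0
      apply (ht j).h_ne_zero
      rw [← (ht j).lie_e_f, show e j = 0 from congrArg Subtype.val h0, zero_lie]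
    have hfi : f i ∈ LieAlgebra.rootSpace H j.1 := by rw [hj]; exact hf i
    obtain ⟨c, hc⟩ := (finrank_eq_one_iff_of_nonzero' _ he0).mp h1 ⟨f i, hfi⟩
    exact ⟨c, (congrArg Subtype.val hc).symm⟩

variable {H} (R : RootVectors H)

/-- Each root vector `e i` acts injectively if `i ∈ I`, and locally nilpotently otherwise. -/
structure IsTyped (Q : Type*) [AddCommGroup Q] [Module (U g) Q] (I : Set H.root) : Prop where
  inj : ∀ i ∈ I, ∀ v : Q, toU (R.e i) • v = 0 → v = 0
  nil : ∀ i ∉ I, ∀ v : Q, ∃ k : ℕ, toU (R.e i) ^ k • v = 0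

/-- The saturation of the subgroup generated by the roots in `I`. -/
def satSpan (I : Set H.root) : Submodule ℤ (Module.Dual ℂ H) :=
  saturation (Submodule.span ℤ ((rootSystem H).root '' I))

end RootVectors

/-! ### Supports of typed modules. -/

namespace IsTyped

variable {g : Type*} [LieRing g] [LieAlgebra ℂ g] [FiniteDimensional ℂ g] [LieAlgebra.IsKilling ℂ g]
  {H : LieSubalgebra ℂ g} [H.IsCartanSubalgebra] {R : RootVectors H}
  {I : Set H.root}

theorem notMem_of_root_notMem {i : H.root} (hi : (rootSystem H).root i ∉ satSpan I) : i ∉ I :=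
  fun h => hi (le_saturation _ (Submodule.subset_span ⟨i, h, rfl⟩))

variable {Q : Type*} [AddCommGroup Q] [Module (U g) Q]

theorem nil_e (hI : IsTyped R Q I) {i : H.root} (hi : (rootSystem H).root i ∉ satSpan I) (v : Q) :
    ∃ k : ℕ, toU (R.e i) ^ k • v = 0 :=
  hI.nil i (notMem_of_root_notMem hi) v

variable [Module ℂ Q] [IsScalarTower ℂ (U g) Q]

theorem add_root_mem_supp (hI : IsTyped R Q I) {i : H.root} (hi : i ∈ I) {ν : Module.Dual ℂ H}
    (hν : ν ∈ supp H Q) : ν + (rootSystem H).root i ∈ supp H Q := by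
  obtain ⟨v, hv, hv0⟩ := mem_supp_iff.mp hν
  exact mem_supp_iff.mpr ⟨_, toU_smul_mem_weightSpace (R.triple i).lie_e hv,
    fun h => hv0 (hI.inj i hi v h)⟩

theorem add_sum_mem_supp (hI : IsTyped R Q I) (s : Finset H.root) (hs : ∀ i ∈ s, i ∈ I)
    (c : H.root → ℕ) {ν : Module.Dual ℂ H} (hν : ν ∈ supp H Q) :
    ν + ∑ i ∈ s, c i • (rootSystem H).root i ∈ supp H Q := by
  classical
  induction s using Finset.induction_on with
  | empty => simpa using hν
  | insert i s his ih =>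
    have h1 := ih fun j hj => hs j (Finset.mem_insert_of_mem hj)
    rw [Finset.sum_insert his]
    induction c i with
    | zero => simpa using h1
    | succ n hn =>
      convert hI.add_root_mem_supp (hs i (Finset.mem_insert_self _ _)) hn using 1
      rw [succ_nsmul]; abel

/-- The saturated span is closed under negation, so the opposite root also lies outside it, and `f
i` is a multiple of its root vector. -/
theorem nil_f (hI : IsTyped R Q I) {i : H.root} (hi : (rootSystem H).root i ∉ satSpan I) (v : Q) :
    ∃ k : ℕ, toU (R.f i) ^ k • v = 0 := by
  have hj : (rootSystem H).root ((rootSystem H).reflectionPerm i i) = -(rootSystem H).root i := by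
    rw [RootPairing.root_reflectionPerm, RootPairing.reflection_apply_self]
  obtain ⟨c, hc⟩ := R.exists_f_eq i _ hj
  obtain ⟨k, hk⟩ := hI.nil_e (i := (rootSystem H).reflectionPerm i i) (by
    rw [hj]; exact fun h => hi (by simpa using h)) v
  refine ⟨k, ?_⟩
  have : toU (R.f i) = c • toU (R.e ((rootSystem H).reflectionPerm i i)) := by
    rw [hc]; exact map_smul (UniversalEnvelopingAlgebra.ι ℂ) _ _
  rw [this, smul_pow, smul_assoc, hk, smul_zero]

end IsTyped

namespace IsTyped

variable {g : Type*} [LieRing g] [LieAlgebra ℂ g] [FiniteDimensional ℂ g] [LieAlgebra.IsKilling ℂ g]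
  {H : LieSubalgebra ℂ g} [H.IsCartanSubalgebra] {R : RootVectors H}
  {Q : Type*} [AddCommGroup Q] [Module ℂ Q] [Module (U g) Q] [IsScalarTower ℂ (U g) Q]
  {I : Set H.root}

/-- Roots outside the span of the injective roots are orthogonal to the injective roots. -/
theorem pairing_eq_zero (hI : IsTyped R Q I) (hfd : ∀ ν, FiniteDimensional ℂ (weightSpace H Q ν))
    (hne : (supp H Q).Nonempty) {i j : H.root} (hi : i ∈ I)
    (hj : (rootSystem H).root j ∉ satSpan I) : (rootSystem H).pairing i j = 0 := by
  obtain ⟨ν, hν⟩ := hne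
  obtain ⟨c, hc⟩ := RootPairing.IsValuedIn.exists_value (P := rootSystem H) (S := ℤ) i j
  have hrefl : ∀ κ ∈ supp H Q,
      κ - κ ((rootSystem H).coroot j) • (rootSystem H).root j ∈ supp H Q := fun κ hκ =>
    (R.triple j).reflection_mem_supp (hI.nil_e hj) (hI.nil_f hj) hκ
  have hk : (rootSystem H).root ((rootSystem H).reflectionPerm j i) =
      (rootSystem H).root i - (rootSystem H).pairing i j • (rootSystem H).root j := by
    rw [RootPairing.root_reflectionPerm, RootPairing.reflection_apply_root]
  -- Injectivity along `i` gives an infinite string of weights. The reflection in `j` preserves the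
  -- support and turns it into an infinite string along the reflected root, whose vector thus cannot
  -- act locally nilpotently.
  have hkI : (rootSystem H).reflectionPerm j i ∈ I := by
    by_contra hkI
    refine (R.triple _).not_forall_add_nsmul_mem_supp hfd (hI.nil _ hkI)
      (ν - ν ((rootSystem H).coroot j) • (rootSystem H).root j) fun n => ?_
    have h1 := hI.add_sum_mem_supp {i} (by simpa using hi) (fun _ => n) hν
    have h2 := hrefl _ h1
    rw [Finset.sum_singleton, LinearMap.add_apply, LinearMap.smul_apply,
      show (rootSystem H).root i ((rootSystem H).coroot j) = (rootSystem H).pairing i j from rfl]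
      at h2
    convert h2 using 1
    rw [hk]
    module
  by_contra hp
  have hc0 : c ≠ 0 := by
    rintro rfl
    exact hp (by rw [← hc, map_zero])
  -- With a nonzero pairing `c`, the multiple `c α_j` is the difference of `α_i` and its reflection,
  -- both in `I`.
  refine hj ⟨c, hc0, ?_⟩
  have h3 : c • (rootSystem H).root j = (rootSystem H).root i -
      (rootSystem H).root ((rootSystem H).reflectionPerm j i) := by
    rw [hk, ← hc, ← Int.cast_smul_eq_zsmul ℂ]
    simp
  rw [h3]
  exact Submodule.sub_mem _ (Submodule.subset_span ⟨i, hi, rfl⟩)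
    (Submodule.subset_span ⟨_, hkI, rfl⟩)

/-- Orthogonality to the roots of `I` extends to their span by linearity, and to the saturation by
dividing by `D`. -/
theorem apply_coroot_eq_zero (hI : IsTyped R Q I)
    (hfd : ∀ ν, FiniteDimensional ℂ (weightSpace H Q ν))
    (hne : (supp H Q).Nonempty) {x : Module.Dual ℂ H} (hx : x ∈ satSpan I) {j : H.root}
    (hj : (rootSystem H).root j ∉ satSpan I) : x ((rootSystem H).coroot j) = 0 := by
  obtain ⟨D, hD, hx⟩ := hx
  have key : ∀ y ∈ Submodule.span ℤ ((rootSystem H).root '' I),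
      y ((rootSystem H).coroot j) = 0 := by
    intro y hy
    induction hy using Submodule.span_induction with
    | mem y hy => obtain ⟨i, hi, rfl⟩ := hy; exact hI.pairing_eq_zero hfd hne hi hj
    | zero => rfl
    | add y z _ _ hy hz => rw [LinearMap.add_apply, hy, hz, add_zero]
    | smul c y _ hy => rw [LinearMap.smul_apply, hy, smul_zero]
  have h := key _ hx
  rw [LinearMap.smul_apply] at h
  exact (smul_eq_zero.mp h).resolve_left hD

/-- A typed module has a weight which is small on all roots orthogonal to the injective ones. -/
theorem exists_mem_supp_small (hI : IsTyped R Q I)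
    (hfd : ∀ ν, FiniteDimensional ℂ (weightSpace H Q ν)) (hne : (supp H Q).Nonempty) :
    ∃ ν ∈ supp H Q, ∀ j, (rootSystem H).root j ∉ satSpan I →
      ∃ m : ℤ, ν ((rootSystem H).coroot j) = m ∧ |m| ≤ 1 := by
  classical
  let F : Finset H.root := Finset.univ.filter fun j => (rootSystem H).root j ∉ satSpan I
  have hF : ∀ j, j ∈ F ↔ (rootSystem H).root j ∉ satSpan I := fun j => by
    rw [Finset.mem_filter_univ]
  have hint : ∀ ν ∈ supp H Q, ∀ j ∈ F, ∃ m : ℤ, (rootSystem H).coroot' j ν = m ∧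
      ∀ i : ℕ, (i : ℤ) ≤ m → ν - i • (rootSystem H).root j ∈ supp H Q := by
    intro ν hν j hj
    rw [hF] at hj
    exact (R.triple j).exists_int_of_mem_supp (hI.nil_e hj) (hI.nil_f hj) hν
  have hnat : ∀ ν ∈ supp H Q, ∃ n : ℕ, (n : ℂ) = ∑ i ∈ F, (rootSystem H).coroot' i ν ^ 2 := by
    intro ν hν
    choose! m hm _ using hint ν hν
    refine ⟨∑ i ∈ F, (m i).natAbs ^ 2, ?_⟩
    rw [Nat.cast_sum]
    refine Finset.sum_congr rfl fun i hi => ?_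
    rw [hm i hi, Nat.cast_pow]
    have : (((m i).natAbs : ℤ) : ℂ) ^ 2 = (m i : ℂ) ^ 2 := by
      exact_mod_cast congrArg (Int.cast (R := ℂ)) (Int.natAbs_sq (m i))
    simpa using this
  -- The required weight is one minimising the sum of the squares of its values on the coroots of
  -- `F`.
  have hex : ∃ n : ℕ, ∃ ν ∈ supp H Q, (n : ℂ) = ∑ i ∈ F, (rootSystem H).coroot' i ν ^ 2 := by
    obtain ⟨ν, hν⟩ := hne
    obtain ⟨n, hn⟩ := hnat ν hν
    exact ⟨n, ν, hν, hn⟩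
  obtain ⟨ν, hν, hn⟩ := Nat.find_spec hex
  have hle : ∀ j ∈ F, ∀ m : ℤ, (rootSystem H).coroot' j ν = m → m ≤ 1 := by
    intro j hj m hm
    -- For `m ≥ 2` the string contains `ν - α_j`, whose sum of squares is smaller by `(m - 1) ∑
    -- p_i²`, at least `4` because `p_j = 2`.
    by_contra! hm2
    obtain ⟨m', hm', hstr⟩ := hint ν hν j hj
    obtain rfl : m' = m := by exact_mod_cast hm'.symm.trans hm
    have h1 := hstr 1 (by push_cast; omega)
    rw [one_smul] at h1
    obtain ⟨n', hn'⟩ := hnat _ h1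
    have hn'' := hn'
    rw [sum_coroot_sub_root_sq, ← hn, hm] at hn'
    · choose p hp using fun i => RootPairing.IsValuedIn.exists_value (P := rootSystem H) (S := ℤ) j i
      simp only [← hp, eq_intCast] at hn'
      have h2 : (n' : ℤ) = (Nat.find hex : ℤ) - (m' - 1) * ∑ i ∈ F, p i ^ 2 := by
        have : ((n' : ℤ) : ℂ) = (((Nat.find hex : ℤ) - (m' - 1) * ∑ i ∈ F, p i ^ 2 : ℤ) : ℂ) := by
          push_cast
          simpa using hn'
        exact_mod_cast this
      have h3 : p j = 2 := by
        have := hp j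
        rw [RootPairing.pairing_same, eq_intCast] at this
        exact_mod_cast this
      have h4 : p j ^ 2 ≤ ∑ i ∈ F, p i ^ 2 :=
        Finset.single_le_sum (f := fun i => p i ^ 2) (fun i _ => sq_nonneg _) hj
      rw [h3] at h4
      refine Nat.find_min hex (m := n') ?_ ⟨_, h1, hn''⟩
      have : (n' : ℤ) < Nat.find hex := by nlinarith
      exact_mod_cast this
    · intro i hi
      rw [hF, not_not] at hi
      rw [hF] at hj
      rw [RootPairing.pairing_eq_zero_iff]
      exact hI.apply_coroot_eq_zero hfd hne hi hj
  refine ⟨ν, hν, fun j hj => ?_⟩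
  obtain ⟨m, hm, -⟩ := hint ν hν j ((hF j).mpr hj)
  refine ⟨m, hm, abs_le.mpr ⟨?_, hle j ((hF j).mpr hj) m hm⟩⟩
  -- The lower bound `-1` is the upper bound for the opposite root.
  have hroot : (rootSystem H).root ((rootSystem H).reflectionPerm j j) = -(rootSystem H).root j := by
    rw [RootPairing.root_reflectionPerm, RootPairing.reflection_apply_self]
  have hcoroot : (rootSystem H).coroot ((rootSystem H).reflectionPerm j j) =
      -(rootSystem H).coroot j := by
    rw [RootPairing.coroot_reflectionPerm, RootPairing.coreflection_apply_self]
  have h5 := hle ((rootSystem H).reflectionPerm j j) ((hF _).mpr (by rw [hroot]; simpa using hj))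
    (-m) (by
      rw [Int.cast_neg, ← hm]
      change ν ((rootSystem H).coroot _) = -ν ((rootSystem H).coroot j)
      rw [hcoroot, map_neg])
  omega

end IsTyped

/-! ### Dimension counting and finite index. -/

theorem card_le_finrank_of_strict_drops {E : Type*} [AddCommGroup E] [Module ℂ E]
    [FiniteDimensional ℂ E] (F : ℕ → Submodule ℂ E) (hF : ∀ n, F (n + 1) ≤ F n) (t : Finset ℕ)
    (ht : ∀ n ∈ t, F (n + 1) < F n) : t.card ≤ Module.finrank ℂ E := by
  -- Every strict drop below `N` uses up a dimension no longer present in `F N`.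
  have key : ∀ N, (t.filter (· < N)).card + Module.finrank ℂ (F N) ≤ Module.finrank ℂ E := by
    intro N
    induction N with
    | zero => simpa using (F 0).finrank_le
    | succ N ih =>
      by_cases hN : N ∈ t
      · have h1 := Submodule.finrank_lt_finrank_of_lt (ht N hN)
        have h2 : t.filter (· < N + 1) = insert N (t.filter (· < N)) := by
          ext k; simp only [Finset.mem_filter, Finset.mem_insert]
          constructor
          · rintro ⟨a, b⟩; by_cases k = N <;> simp_all; omega
          · rintro (rfl | ⟨a, b⟩); exacts [⟨hN, by omega⟩, ⟨a, by omega⟩]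
        rw [h2, Finset.card_insert_of_notMem (by simp)]
        omega
      · have h1 := Submodule.finrank_mono (hF N)
        have h2 : t.filter (· < N + 1) = t.filter (· < N) := by
          refine Finset.filter_congr fun k hk => ?_
          have : k ≠ N := fun h => hN (h ▸ hk)
          omega
        rw [h2]; omega
  have h := key (t.sup id + 1)
  rw [Finset.filter_true_of_mem] at h
  · omega
  · intro k hk
    exact Nat.lt_succ_of_le (Finset.le_sup (f := id) hk)

theorem exists_eq_sum_of_mem_span_image {ι V : Type*} [Fintype ι] [AddCommGroup V] (v : ι → V)
    (s : Finset ι) {x : V} (hx : x ∈ Submodule.span ℤ (v '' s)) :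
    ∃ c : ι → ℤ, x = ∑ i ∈ s, c i • v i := by
  classical
  induction hx using Submodule.span_induction with
  | mem y hy =>
    obtain ⟨i, hi, rfl⟩ := hy
    refine ⟨Pi.single i 1, ?_⟩
    rw [Finset.sum_eq_single i]
    · simp
    · intro j _ hj; simp [hj]
    · intro h; exact absurd hi h
  | zero => exact ⟨0, by simp⟩
  | add y z _ _ hy hz =>
    obtain ⟨c, rfl⟩ := hy
    obtain ⟨d, rfl⟩ := hz
    exact ⟨c + d, by simp [add_smul, Finset.sum_add_distrib]⟩
  | smul a y _ hy =>
    obtain ⟨c, rfl⟩ := hy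
    exact ⟨a • c, by simp [mul_smul, Finset.smul_sum]⟩

/-- A subgroup of finite rank has finite index in its relative saturation: infinitely many
elements of the latter contain infinitely many in the same coset. -/
theorem exists_infinite_sub_mem_of_saturation {V : Type*} [AddCommGroup V] (L G : Submodule ℤ V)
    (hG : G.FG) (T : Set ℕ) (hT : T.Infinite) (ν : ℕ → V)
    (hν : ∀ m ∈ T, ∀ n ∈ T, ν m - ν n ∈ G ⊓ saturation L) :
    ∃ T' ⊆ T, T'.Infinite ∧ ∀ m ∈ T', ∀ n ∈ T', ν m - ν n ∈ L := by
  obtain ⟨n₀, hn₀⟩ := hT.nonempty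
  let K := G ⊓ saturation L
  have : IsNoetherian ℤ G := isNoetherian_of_fg_of_noetherian G hG
  have : Module.Finite ℤ K := Module.Finite.of_injective
    (Submodule.inclusion (inf_le_left : K ≤ G)) (Submodule.inclusion_injective _)
  -- A finitely generated torsion abelian group is finite, so the pigeonhole principle applies to
  -- the cosets.
  have hfin : Finite (K ⧸ L.comap K.subtype) := by
    refine Module.finite_of_fg_torsion _ fun {x} => ?_
    obtain ⟨x, rfl⟩ := Submodule.mkQ_surjective _ x
    obtain ⟨D, hD, hx⟩ := x.2.2
    refine ⟨⟨D, mem_nonZeroDivisors_of_ne_zero hD⟩, ?_⟩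
    change D • (L.comap K.subtype).mkQ x = 0
    rw [← map_smul]
    exact (Submodule.Quotient.mk_eq_zero _).mpr hx
  have := hT.to_subtype
  obtain ⟨y, hy⟩ := Finite.exists_infinite_fiber
    (fun n : T => (L.comap K.subtype).mkQ ⟨ν n - ν n₀, hν n n.2 n₀ hn₀⟩)
  refine ⟨(fun n : T => n.1) '' ((fun n : T =>
    (L.comap K.subtype).mkQ ⟨ν n - ν n₀, hν n n.2 n₀ hn₀⟩) ⁻¹' {y}), ?_, ?_, ?_⟩
  · rintro _ ⟨n, -, rfl⟩; exact n.2
  · exact (Set.infinite_coe_iff.mp hy).image Subtype.val_injective.injOn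
  · rintro _ ⟨m, hm, rfl⟩ _ ⟨n, hn, rfl⟩
    have h1 := (Submodule.Quotient.eq _).mp (hm.trans hn.symm)
    have h2 : (ν m - ν n₀) - (ν n - ν n₀) ∈ L := h1
    simpa using h2

/-! ### Separating root lattice elements by coroots. -/

section Lattice

variable {g : Type*} [LieRing g] [LieAlgebra ℂ g] [FiniteDimensional ℂ g] [LieAlgebra.IsKilling ℂ g]
  (H : LieSubalgebra ℂ g) [H.IsCartanSubalgebra]

/-- The root lattice. -/
def rootLattice : Submodule ℤ (Module.Dual ℂ H) :=
  Submodule.span ℤ (Set.range (rootSystem H).root)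

variable {H}

/-- Orthogonality splits `x = y + z`, with `y` in the saturated span and `z` spanned by the
remaining roots. Then `z` vanishes on every coroot: on those of the saturated span by orthogonality,
on the others because `x` and `y` do. Coroots span, so `z = 0`. -/
theorem mem_satSpan_of_apply_coroot_eq_zero {I : Set H.root}
    (hI : ∀ x ∈ satSpan I, ∀ j, (rootSystem H).root j ∉ satSpan I →
      x ((rootSystem H).coroot j) = 0) {x : Module.Dual ℂ H} (hx : x ∈ rootLattice H)
    (h0 : ∀ j, (rootSystem H).root j ∉ satSpan I → x ((rootSystem H).coroot j) = 0) :
    x ∈ satSpan I := by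
  let J : Set H.root := {j | (rootSystem H).root j ∉ satSpan I}
  have h1 : rootLattice H ≤ satSpan I ⊔ Submodule.span ℤ ((rootSystem H).root '' J) := by
    refine Submodule.span_le.mpr ?_
    rintro _ ⟨j, rfl⟩
    by_cases hj : (rootSystem H).root j ∈ satSpan I
    · exact (le_sup_left : satSpan I ≤ _) hj
    · exact (le_sup_right : Submodule.span ℤ ((rootSystem H).root '' J) ≤ _)
        (Submodule.subset_span ⟨j, hj, rfl⟩)
  have h2 : ∀ z ∈ Submodule.span ℤ ((rootSystem H).root '' J), ∀ j,
      (rootSystem H).root j ∈ satSpan I → z ((rootSystem H).coroot j) = 0 := by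
    intro z hz j hj
    induction hz using Submodule.span_induction with
    | mem w hw =>
      obtain ⟨i, hi, rfl⟩ := hw
      change (rootSystem H).pairing i j = 0
      rw [RootPairing.pairing_eq_zero_iff]
      exact hI _ hj i hi
    | zero => rfl
    | add u w _ _ hu hw => rw [LinearMap.add_apply, hu, hw, add_zero]
    | smul c u _ hu => rw [LinearMap.smul_apply, hu, smul_zero]
  obtain ⟨y, hy, z, hz, rfl⟩ := Submodule.mem_sup.mp (h1 hx)
  have hz0 : ∀ j, z ((rootSystem H).coroot j) = 0 := by
    intro j
    by_cases hj : (rootSystem H).root j ∈ satSpan I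
    · exact h2 z hz j hj
    · have h3 := h0 j hj
      rwa [LinearMap.add_apply, hI y hy j hj, zero_add] at h3
  have hz' : z = 0 := by
    have h3 : Submodule.span ℂ (Set.range (rootSystem H).coroot) ≤ LinearMap.ker z := by
      rw [Submodule.span_le]
      rintro _ ⟨j, rfl⟩
      exact hz0 j
    rw [RootPairing.IsRootSystem.span_coroot_eq_top, top_le_iff] at h3
    exact LinearMap.ker_eq_top.mp h3
  rw [hz', add_zero]
  exact hy

/-- Two pigeonholes: first fix the values in `{-1, 0, 1}` on the outer coroots, which puts
differences into the saturated span, then use that the span of `I` has finite index in the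
saturation within the root lattice. -/
theorem exists_infinite_sub_mem_span {I : Set H.root}
    (hI : ∀ x ∈ satSpan I, ∀ j, (rootSystem H).root j ∉ satSpan I →
      x ((rootSystem H).coroot j) = 0) (T : Set ℕ) (hT : T.Infinite) (ν : ℕ → Module.Dual ℂ H)
    (hν : ∀ m ∈ T, ∀ n ∈ T, ν m - ν n ∈ rootLattice H)
    (hsmall : ∀ n ∈ T, ∀ j, (rootSystem H).root j ∉ satSpan I →
      ∃ m : ℤ, ν n ((rootSystem H).coroot j) = m ∧ |m| ≤ 1) :
    ∃ T' ⊆ T, T'.Infinite ∧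
      ∀ m ∈ T', ∀ n ∈ T', ν m - ν n ∈ Submodule.span ℤ ((rootSystem H).root '' I) := by
  classical
  choose! d hd hd1 using hsmall
  have := hT.to_subtype
  let φ : T → ({j // (rootSystem H).root j ∉ satSpan I} → Set.Icc (-1 : ℤ) 1) := fun n j =>
    ⟨d n j, abs_le.mp (hd1 n n.2 j j.2)⟩
  obtain ⟨y, hy⟩ := Finite.exists_infinite_fiber φ
  obtain ⟨T', hT', hinf, h⟩ := exists_infinite_sub_mem_of_saturation
    (Submodule.span ℤ ((rootSystem H).root '' I)) (rootLattice H)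
    (Submodule.fg_span (Set.finite_range _)) ((fun n : T => n.1) '' (φ ⁻¹' {y}))
    ((Set.infinite_coe_iff.mp hy).image Subtype.val_injective.injOn) ν (by
      rintro _ ⟨m, hm, rfl⟩ _ ⟨n, hn, rfl⟩
      refine ⟨hν m m.2 n n.2, mem_satSpan_of_apply_coroot_eq_zero hI (hν m m.2 n n.2) ?_⟩
      intro j hj
      have h1 : d m j = d n j :=
        congrArg Subtype.val (congrFun (hm.trans hn.symm : φ m = φ n) ⟨j, hj⟩)
      rw [LinearMap.sub_apply, hd m m.2 j hj, hd n n.2 j hj, h1, sub_self])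
  refine ⟨T', hT'.trans ?_, hinf, h⟩
  rintro _ ⟨n, -, rfl⟩
  exact n.2

end Lattice

/-! ### The Artinian property of bounded weight modules. -/

section Artinian

variable {g : Type*} [LieRing g] [LieAlgebra ℂ g] [FiniteDimensional ℂ g] [LieAlgebra.IsKilling ℂ g]
  {H : LieSubalgebra ℂ g} [H.IsCartanSubalgebra]
  {V : Type*} [AddCommGroup V] [Module ℂ V] [Module (U g) V] [IsScalarTower ℂ (U g) V]

/-- A nonzero subquotient `A / B` of a weight module contains a typed submodule; we record the
consequences for the set `S` of its weights. -/
theorem exists_typed_layer (hV : ⨆ μ, weightSpace H V μ = ⊤)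
    (hfd : ∀ ν, FiniteDimensional ℂ (weightSpace H V ν)) {A B : Submodule (U g) V} (hBA : B < A) :
    ∃ (I : Set H.root) (S : Set (Module.Dual ℂ H)),
      (∃ ν ∈ S, ∀ j, (rootSystem H).root j ∉ satSpan I →
        ∃ m : ℤ, ν ((rootSystem H).coroot j) = m ∧ |m| ≤ 1) ∧
      (∀ x ∈ satSpan I, ∀ j, (rootSystem H).root j ∉ satSpan I →
        x ((rootSystem H).coroot j) = 0) ∧
      (∀ ν ∈ S, ∀ (s : Finset H.root) (c : H.root → ℕ), (∀ i ∈ s, i ∈ I) →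
        ν + ∑ i ∈ s, c i • (rootSystem H).root i ∈ S) ∧
      ∀ ν ∈ S, ∃ w ∈ weightSpace H V ν, w ∈ A ∧ w ∉ B := by
  obtain ⟨R⟩ := nonempty_rootVectors H
  have hA : A.map B.mkQ ≠ ⊥ := by
    obtain ⟨v, hvA, hvB⟩ := SetLike.exists_of_lt hBA
    refine (Submodule.ne_bot_iff _).mpr ⟨B.mkQ v, ⟨v, hvA, rfl⟩, fun h => hvB ?_⟩
    exact (Submodule.Quotient.mk_eq_zero B).mp h
  obtain ⟨P, hPA, hP, I, hinj, hnil⟩ := exists_le_injective_or_nilpotent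
    (fun i => toU (R.e i)) (fun i u => exists_adEnd_pow_toU_eq_zero _ (R.isNilpotent_ad i) u) hA
  have hI : IsTyped R P I := by
    refine ⟨fun i hi v hv => ?_, fun i hi v => ?_⟩
    · exact Subtype.ext (hinj i hi v v.2 (congrArg Subtype.val hv))
    · obtain ⟨k, hk⟩ := hnil i hi v v.2
      exact ⟨k, Subtype.ext hk⟩
  have hfdP : ∀ ν, FiniteDimensional ℂ (weightSpace H P ν) := fun ν => by
    have := finiteDimensional_weightSpace_quotient hV B (ν := ν)
    exact finiteDimensional_weightSpace_submodule P
  have hne : (supp H P).Nonempty := by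
    obtain ⟨ν, hν⟩ := exists_weight_vector_mem (iSup_weightSpace_quotient hV B) hP
    exact ⟨ν, (supp_submodule_iff P).mpr hν⟩
  refine ⟨I, supp H P, hI.exists_mem_supp_small hfdP hne,
    fun x hx j hj => hI.apply_coroot_eq_zero hfdP hne hx hj,
    fun ν hν s c hs => hI.add_sum_mem_supp s hs c hν, fun ν hν => ?_⟩
  obtain ⟨v, hv, hvP, hv0⟩ := (supp_submodule_iff P).mp hν
  obtain ⟨v', hv'A, rfl⟩ := hPA hvP
  obtain ⟨w, hw, hwv⟩ := exists_mem_weightSpace_sub_mem hV B (ν := ν) (v := v') fun h => by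
    rw [← Submodule.Quotient.mk_eq_zero, Submodule.Quotient.mk_sub, sub_eq_zero]
    exact hv h
  refine ⟨w, hw, ?_, fun hwB => hv0 ?_⟩
  · rw [← sub_add_cancel w v']
    exact A.add_mem (hBA.le hwv) hv'A
  · refine (Submodule.Quotient.mk_eq_zero B).mpr ?_
    have := B.sub_mem hwB hwv
    rwa [sub_sub_cancel] at this

/-- A weight module with uniformly bounded multiplicities and support in one coset of the root
lattice is Artinian. -/
theorem isArtinian_of_bounded (hV : ⨆ μ, weightSpace H V μ = ⊤)
    (hfd : ∀ ν, FiniteDimensional ℂ (weightSpace H V ν)) (C : ℕ)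
    (hC : ∀ ν, Module.finrank ℂ (weightSpace H V ν) ≤ C) (lam : Module.Dual ℂ H)
    (hsupp : ∀ ν ∈ supp H V, ν - lam ∈ rootLattice H) : IsArtinian (U g) V := by
  classical
  rw [isArtinian_iff, RelEmbedding.wellFounded_iff_isEmpty]
  refine ⟨fun W => ?_⟩
  have hW : ∀ n, W (n + 1) < W n := fun n => W.map_rel_iff.mpr (Nat.lt_succ_self n)
  choose I S hsmall horth hcone hlift using fun n => exists_typed_layer hV hfd (hW n)
  choose ν hν hνs using hsmall
  have hmem : ∀ n, ∀ κ ∈ S n, κ - lam ∈ rootLattice H := fun n κ hκ => by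
    obtain ⟨w, hw, -, hwB⟩ := hlift n κ hκ
    exact hsupp κ (mem_supp_iff.mpr ⟨w, hw, fun h => hwB (h ▸ Submodule.zero_mem _)⟩)
  -- There are finitely many sets of roots, so infinitely many layers share their injective roots.
  obtain ⟨I₀, hI₀⟩ := Finite.exists_infinite_fiber I
  obtain ⟨T, hTI, hT, hdiff⟩ := exists_infinite_sub_mem_span (I := I₀) (by
      obtain ⟨n, hn⟩ := (Set.infinite_coe_iff.mp hI₀).nonempty
      obtain rfl : I n = I₀ := hn
      exact horth n) (I ⁻¹' {I₀}) (Set.infinite_coe_iff.mp hI₀) ν (by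
      intro m _ n _
      simpa using (rootLattice H).sub_mem (hmem m _ (hν m)) (hmem n _ (hν n))) (by
      intro n hn
      obtain rfl : I n = I₀ := hn
      exact hνs n)
  obtain ⟨t, htT, ht⟩ := hT.exists_subset_card_eq (C + 1)
  obtain ⟨n₀, hn₀⟩ := hT.nonempty
  let s : Finset H.root := Finset.univ.filter (· ∈ I₀)
  have hs : ∀ i, i ∈ s ↔ i ∈ I₀ := fun i => Finset.mem_filter_univ i
  have hs' : (s : Set H.root) = I₀ := Set.ext hs
  have hc : ∀ n ∈ t, ∃ c : H.root → ℤ, ν n - ν n₀ = ∑ i ∈ s, c i • (rootSystem H).root i :=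
    fun n hn => exists_eq_sum_of_mem_span_image _ s (by
      rw [hs']; exact hdiff n (htT hn) n₀ hn₀)
  choose! c hc using hc
  -- A bound for all the coefficients, so that `ν n₀ + N ∑ α_i` is obtained from each `ν n`, `n ∈
  -- t`, by adding roots of `I₀` with nonnegative multiplicities.
  let N : ℤ := ∑ n ∈ t, ∑ i ∈ s, |c n i|
  have hN : ∀ n ∈ t, ∀ i ∈ s, c n i ≤ N := fun n hn i hi =>
    (le_abs_self _).trans <| (Finset.single_le_sum (f := fun i => |c n i|)
      (fun _ _ => abs_nonneg _) hi).trans <| Finset.single_le_sum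
      (f := fun n => ∑ i ∈ s, |c n i|) (fun _ _ => Finset.sum_nonneg fun _ _ => abs_nonneg _) hn
  let κ : Module.Dual ℂ H := ν n₀ + ∑ i ∈ s, N • (rootSystem H).root i
  have hκ : ∀ n ∈ t, κ ∈ S n := by
    intro n hn
    have h1 := hcone n (ν n) (hν n) s (fun i => (N - c n i).toNat) (by
      intro i hi
      have h2 : I n = I₀ := hTI (htT hn)
      rw [h2, ← hs]; exact hi)
    convert h1 using 1
    rw [sub_eq_iff_eq_add.mp (hc n hn), add_comm _ (ν n₀), add_assoc, ← Finset.sum_add_distrib]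
    refine congrArg (ν n₀ + ·) (Finset.sum_congr rfl fun i hi => ?_)
    rw [← natCast_zsmul, Int.toNat_of_nonneg (sub_nonneg.mpr (hN n hn i hi)), ← add_smul,
      add_sub_cancel]
  -- The chain restricted to the common weight `κ` drops strictly at all `C + 1` indices in `t`.
  let F : ℕ → Submodule ℂ (weightSpace H V κ) := fun n =>
    ((W n).restrictScalars ℂ).comap (weightSpace H V κ).subtype
  have h1 := card_le_finrank_of_strict_drops F (fun n v hv => (hW n).le hv) t fun n hn => by
    obtain ⟨w, hw, hwA, hwB⟩ := hlift n κ (hκ n hn)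
    exact SetLike.lt_iff_le_and_exists.mpr
      ⟨fun v hv => (hW n).le hv, ⟨w, hw⟩, hwA, hwB⟩
  have := hC κ
  omega

end Artinian

/-! ### Existence of simple submodules. -/

section SimpleSubmodules

variable {g : Type*} [LieRing g] [LieAlgebra ℂ g] [FiniteDimensional ℂ g] [LieAlgebra.IsKilling ℂ g]
  {H : LieSubalgebra ℂ g} [H.IsCartanSubalgebra]
  {M : Type*} [AddCommGroup M] [Module ℂ M] [Module (U g) M] [IsScalarTower ℂ (U g) M]

theorem toLinear_mem_rootLattice (χ : LieModule.Weight ℂ H g) :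
    χ.toLinear ∈ rootLattice H := by
  by_cases hχ : χ.IsZero
  · have : χ.toLinear = 0 := by ext x; simp [hχ.eq]
    rw [this]; exact Submodule.zero_mem _
  · exact Submodule.subset_span ⟨⟨χ, by simpa using hχ⟩, rfl⟩

/-- The elements of `U(𝔤)` preserving this sum form a subalgebra, and root vectors shift weights by
elements of the root lattice. -/
theorem smul_mem_iSup_weightSpace (lam : Module.Dual ℂ H) (u : U g) :
    ∀ w ∈ ⨆ (μ : Module.Dual ℂ H) (_ : μ - lam ∈ rootLattice H), weightSpace H M μ,
      u • w ∈ ⨆ (μ : Module.Dual ℂ H) (_ : μ - lam ∈ rootLattice H), weightSpace H M μ := by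
  set S : Submodule ℂ M :=
    ⨆ (μ : Module.Dual ℂ H) (_ : μ - lam ∈ rootLattice H), weightSpace H M μ with hS
  let B : Subalgebra ℂ (U g) :=
    { carrier := {u | ∀ w ∈ S, u • w ∈ S}
      mul_mem' := fun {a b} ha hb w hw => by rw [mul_smul]; exact ha _ (hb _ hw)
      add_mem' := fun {a b} ha hb w hw => by
        rw [add_smul]; exact S.add_mem (ha _ hw) (hb _ hw)
      algebraMap_mem' := fun c w hw => by
        rw [algebraMap_smul]; exact S.smul_mem c hw }
  refine mem_subalgebra_of_toU_mem B (fun x => ?_) u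
  have hx : x ∈ ⨆ χ : LieModule.Weight ℂ H g, (LieAlgebra.rootSpace H χ).toSubmodule := by
    have h1 := LieModule.iSup_genWeightSpace_eq_top' ℂ H g
    have h2 := congrArg LieSubmodule.toSubmodule h1
    rw [LieSubmodule.iSup_toSubmodule] at h2
    rw [h2]; trivial
  induction hx using Submodule.iSup_induction' with
  | mem χ x hx =>
    intro w hw
    obtain ⟨s, v, hs, hv, rfl⟩ := exists_sum_weight_eq hw
    rw [Finset.smul_sum]
    refine S.sum_mem fun μ hμ => ?_
    refine Submodule.mem_iSup_of_mem (μ + χ.toLinear) (Submodule.mem_iSup_of_mem ?_ ?_)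
    · rw [add_sub_right_comm]
      exact Submodule.add_mem _ (hs μ hμ) (toLinear_mem_rootLattice χ)
    · exact toU_smul_mem_weightSpace (fun h => lie_eq_smul_of_mem_rootSpace hx h) (hv μ)
  | zero => rw [toU, map_zero]; exact B.zero_mem
  | add x y _ _ hx hy => rw [toU, map_add]; exact B.add_mem hx hy

theorem sub_mem_rootLattice_of_mem_supp_span {lam : Module.Dual ℂ H} {v : M}
    (hv : v ∈ weightSpace H M lam) :
    ∀ ν ∈ supp H (Submodule.span (U g) {v}), ν - lam ∈ rootLattice H := by
  classical
  intro ν hν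
  obtain ⟨w, hw, hwV, hw0⟩ := (supp_submodule_iff _).mp hν
  obtain ⟨u, rfl⟩ := Submodule.mem_span_singleton.mp hwV
  have h1 := smul_mem_iSup_weightSpace (M := M) lam u v (Submodule.mem_iSup_of_mem lam
    (Submodule.mem_iSup_of_mem (by simp) hv))
  obtain ⟨s, x, hs, hx, hsum⟩ := exists_sum_weight_eq h1
  by_contra hνs
  have hνs' : ν ∉ s := fun h => hνs (hs ν h)
  -- Subtracting the vector of weight `ν` from its expansion in other weights gives zero; gradedness
  -- of the zero submodule forces the vector to vanish.
  have h2 := mem_of_sum_weight_mem (⊥ : Submodule (U g) M) (insert ν s)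
    (fun μ => if μ = ν then -(u • v) else x μ) (fun μ _ => by
      split_ifs with h
      · rw [h]; exact Submodule.neg_mem _ hw
      · exact hx μ) (by
      rw [Finset.sum_insert hνs', if_pos rfl, Finset.sum_congr rfl fun μ hμ =>
        if_neg (fun h : μ = ν => hνs' (h ▸ hμ)), hsum]
      simp) ν (Finset.mem_insert_self _ _)
  simp only [if_true, Submodule.mem_bot, neg_eq_zero] at h2
  exact hw0 h2

/-- Nonzero submodules of weight modules with uniformly bounded multiplicities have simple
submodules. -/
theorem exists_isSimpleModule_le (hM : ⨆ μ, weightSpace H M μ = ⊤)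
    (hfd : ∀ ν, FiniteDimensional ℂ (weightSpace H M ν)) (C : ℕ)
    (hC : ∀ ν, Module.finrank ℂ (weightSpace H M ν) ≤ C) {K : Submodule (U g) M} (hK : K ≠ ⊥) :
    ∃ S ≤ K, IsSimpleModule (U g) S := by
  obtain ⟨lam, v, hv, hvK, hv0⟩ := exists_weight_vector_mem hM hK
  -- The submodule generated by one weight vector has its support in a single coset of the root
  -- lattice, as the Artinian criterion requires.
  let V := Submodule.span (U g) {v}
  have hVK : V ≤ K := by simpa [V, Submodule.span_le] using hvK
  have hart : IsArtinian (U g) V :=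
    isArtinian_of_bounded (iSup_weightSpace_submodule hM V)
      (fun ν => finiteDimensional_weightSpace_submodule V) C (fun ν => by
        refine le_trans (LinearMap.finrank_le_finrank_of_injective
          (f := (({ toFun := fun w => ⟨w.1.1, fun h => congrArg Subtype.val (w.2 h)⟩
                    map_add' := fun _ _ => rfl
                    map_smul' := fun _ _ => rfl } :
            weightSpace H V ν →ₗ[ℂ] weightSpace H M ν))) fun w w' h => ?_) (hC ν)
        exact Subtype.ext (Subtype.ext
          (congrArg (fun z : weightSpace H M ν => (z : M)) h)))
      lam (sub_mem_rootLattice_of_mem_supp_span hv)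
  have : Nontrivial V := ⟨⟨⟨v, Submodule.mem_span_singleton_self v⟩, 0, fun h =>
    hv0 (congrArg Subtype.val h)⟩⟩
  obtain ⟨S, hS⟩ := IsAtomic.exists_atom (Submodule (U g) V)
  have hS' : IsSimpleModule (U g) S := isSimpleModule_iff_isAtom.mpr hS
  refine ⟨S.map V.subtype, (Submodule.map_subtype_le V S).trans hVK, ?_⟩
  exact IsSimpleModule.congr (Submodule.equivSubtypeMap V S).symm

end SimpleSubmodules

/-! ### The action of the multiplicative set on `M`. -/

section GammaAction

variable {g : Type*} [LieRing g] [LieAlgebra ℂ g] {H : LieSubalgebra ℂ g} [H.IsCartanSubalgebra]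
  {l : ℕ} {T : StandardTriples H} {Γ : CommutingRoots H l}
  {M : Type*} [AddCommGroup M] [Module (U g) M]

theorem smul_injective_of_mem_multSet (hΓ : IsGammaInjective T Γ M) {s : U g}
    (hs : s ∈ multSet T Γ) : Function.Injective fun m : M => s • m := by
  induction hs using Submonoid.closure_induction with
  | mem a ha => obtain ⟨j, rfl⟩ := ha; exact hΓ j
  | one => intro m n h; simpa using h
  | mul x y _ _ hx hy => intro m n h; exact hy (hx (by simpa [mul_smul] using h))

theorem smul_surjective_of_mem_multSet (hΓ : IsGammaBijective T Γ M) {s : U g}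
    (hs : s ∈ multSet T Γ) : Function.Surjective fun m : M => s • m := by
  induction hs using Submonoid.closure_induction with
  | mem a ha => obtain ⟨j, rfl⟩ := ha; exact (hΓ j).2
  | one => intro m; exact ⟨m, one_smul _ _⟩
  | mul x y _ _ hx hy =>
    intro m
    obtain ⟨n, rfl⟩ := hx m
    obtain ⟨k, rfl⟩ := hy n
    exact ⟨k, mul_smul _ _ _⟩

end GammaAction

/-! ### Fractions, weights in `U_{F_Γ}`, and part (i). -/

section LocalizedModules

variable {g : Type*} [LieRing g] [LieAlgebra ℂ g] [IsSpOrSl g] {H : LieSubalgebra ℂ g}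
  [H.IsCartanSubalgebra] {l : ℕ} (T : StandardTriples H) (Γ : CommutingRoots H l)

/-- The canonical map `U(𝔤) → U_{F_Γ}`. -/
noncomputable abbrev toUF : U g →+* UF T Γ := OreLocalization.numeratorRingHom

theorem toUF_smul (c : ℂ) (u : U g) : toUF T Γ (c • u) = c • toUF T Γ u := by
  rw [Algebra.smul_def, map_mul, Algebra.smul_def]; rfl

theorem toUF_f (j : Fin l) : toUF T Γ (toU (T.f (Γ.root j))) = fUnit T Γ j := rfl

theorem isUnit_toUF {s : U g} (hs : s ∈ multSet T Γ) : IsUnit (toUF T Γ s) :=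
  ⟨OreLocalization.numeratorUnit ⟨s, hs⟩, rfl⟩

theorem commute_of_mem_multSet {s t : U g} (hs : s ∈ multSet T Γ) (ht : t ∈ multSet T Γ) :
    Commute s t := by
  induction hs using Submonoid.closure_induction with
  | mem a ha => obtain ⟨j, rfl⟩ := ha; exact commute_fUnit_mem T Γ j t ht
  | one => exact Commute.one_left _
  | mul x y _ _ hx hy => exact hx.mul_left hy

theorem lie_f (j : Fin l) (h : H) :
    ⁅(h : g), T.f (Γ.root j)⁆ = (-Γ.root j) h • T.f (Γ.root j) :=
  LieAlgebra.IsKilling.lie_eq_smul_of_mem_rootSpace (T.f_mem _ (Γ.root_mem j)) h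

/-- The element `w` of `U_{F_Γ}` has weight `κ`. -/
def HasWeight (w : UF T Γ) (κ : Module.Dual ℂ H) : Prop :=
  ∀ h : H, toUF T Γ (toU (h : g)) * w = w * toUF T Γ (toU (h : g)) + κ h • w

variable {T Γ}

namespace HasWeight

variable {w w' : UF T Γ} {κ κ' : Module.Dual ℂ H}

theorem one : HasWeight T Γ 1 0 := fun h => by simp

theorem mul (hw : HasWeight T Γ w κ) (hw' : HasWeight T Γ w' κ') :
    HasWeight T Γ (w * w') (κ + κ') := fun h => by
  rw [← mul_assoc, hw h, add_mul, mul_assoc, hw' h, mul_add, mul_assoc, smul_mul_assoc,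
    mul_smul_comm, LinearMap.add_apply, add_smul]
  abel

theorem inv {w : (UF T Γ)ˣ} (hw : HasWeight T Γ w κ) : HasWeight T Γ (w⁻¹ : (UF T Γ)ˣ) (-κ) :=
  fun h => by
  have h1 := hw h
  have h2 := congrArg (fun z => ((w⁻¹ : (UF T Γ)ˣ) : UF T Γ) * z * ((w⁻¹ : (UF T Γ)ˣ) : UF T Γ)) h1
  simp only [mul_add, add_mul, mul_assoc, Units.mul_inv, Units.inv_mul_cancel_left, mul_one,
    mul_smul_comm, smul_mul_assoc] at h2
  rw [LinearMap.neg_apply, neg_smul, h2, add_neg_cancel_right]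

theorem fUnit (j : Fin l) : HasWeight T Γ (fUnit T Γ j) (-Γ.root j) := fun h => by
  rw [← toUF_f, ← map_mul (toUF T Γ), ← map_mul (toUF T Γ), ← toUF_smul, ← map_add (toUF T Γ)]
  congr 1
  rw [← sub_eq_iff_eq_add', ← toU_lie, lie_f]
  exact map_smul (UniversalEnvelopingAlgebra.ι ℂ) _ _

end HasWeight

variable (T Γ) in
-- Weights of units form a subgroup, and it contains every `-γ`.
theorem exists_unit_hasWeight {κ : Module.Dual ℂ H} (hκ : κ ∈ intSpan Γ) :
    ∃ w : (UF T Γ)ˣ, HasWeight T Γ w κ := by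
  let B : AddSubgroup (Module.Dual ℂ H) :=
    { carrier := {κ | ∃ w : (UF T Γ)ˣ, HasWeight T Γ w κ}
      zero_mem' := ⟨1, HasWeight.one⟩
      add_mem' := fun ⟨w, hw⟩ ⟨w', hw'⟩ => ⟨w * w', hw.mul hw'⟩
      neg_mem' := fun ⟨w, hw⟩ => ⟨w⁻¹, hw.inv⟩ }
  have h : intSpan Γ ≤ B.toIntSubmodule := by
    refine Submodule.span_le.mpr ?_
    rintro _ ⟨j, rfl⟩
    exact B.neg_mem_iff.mp ⟨fUnit T Γ j, HasWeight.fUnit j⟩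
  exact h hκ

theorem exists_hasWeight_of_mem_multSet {s : U g} (hs : s ∈ multSet T Γ) :
    ∃ κ ∈ intSpan Γ, HasWeight T Γ (toUF T Γ s) κ := by
  induction hs using Submonoid.closure_induction with
  | mem a ha =>
    obtain ⟨j, rfl⟩ := ha
    exact ⟨_, Submodule.neg_mem _ (Submodule.subset_span ⟨j, rfl⟩), HasWeight.fUnit j⟩
  | one => exact ⟨0, Submodule.zero_mem _, by rw [map_one]; exact HasWeight.one⟩
  | mul x y _ _ hx hy =>
    obtain ⟨κ, hκ, h⟩ := hx
    obtain ⟨κ', hκ', h'⟩ := hy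
    exact ⟨κ + κ', Submodule.add_mem _ hκ hκ', by rw [map_mul]; exact h.mul h'⟩

variable {M : Type*} [AddCommGroup M] [Module (U g) M]

variable (T Γ M) in
/-- The canonical map `M → 𝒟_Γ M`. -/
noncomputable def toLoc : M →ₗ[U g] Loc T Γ M where
  toFun m := m /ₒ 1
  map_add' _ _ := OreLocalization.add_oreDiv.symm
  map_smul' u m := (OreLocalization.smul_oreDiv_one u m).symm

theorem toUF_smul_toLoc (u : U g) (m : M) : toUF T Γ u • toLoc T Γ M m = toLoc T Γ M (u • m) := by
  rw [map_smul, smul_loc_eq]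

theorem exists_toUF_smul_eq (v : Loc T Γ M) :
    ∃ s ∈ multSet T Γ, ∃ m : M, toUF T Γ s • v = toLoc T Γ M m := by
  induction v using OreLocalization.ind with | _ m s
  exact ⟨s, s.2, m, OreLocalization.smul_cancel⟩

/-- Denominators may simply be multiplied, because `F_Γ` is commutative. -/
theorem exists_common_toUF_smul_eq (F : Finset (Loc T Γ M)) :
    ∃ s ∈ multSet T Γ, ∀ v ∈ F, ∃ m : M, toUF T Γ s • v = toLoc T Γ M m := by
  classical
  induction F using Finset.induction_on with
  | empty => exact ⟨1, Submonoid.one_mem _, by simp⟩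
  | insert v F _ ih =>
    obtain ⟨s, hs, h⟩ := ih
    obtain ⟨t, ht, m, hm⟩ := exists_toUF_smul_eq v
    refine ⟨s * t, Submonoid.mul_mem _ hs ht, fun w hw => ?_⟩
    rcases Finset.mem_insert.mp hw with rfl | hw
    · exact ⟨s • m, by rw [map_mul, mul_smul, hm, toUF_smul_toLoc]⟩
    · obtain ⟨n, hn⟩ := h w hw
      exact ⟨t • n, by rw [(commute_of_mem_multSet T Γ hs ht).eq, map_mul, mul_smul, hn,
        toUF_smul_toLoc]⟩

theorem toLoc_injective (hΓ : IsGammaInjective T Γ M) : Function.Injective (toLoc T Γ M) := by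
  intro m n h
  obtain ⟨u, v, h1, h2⟩ := OreLocalization.oreDiv_eq_iff.mp h
  have h3 : (u : U g) = v := by simpa using h2
  refine (smul_injective_of_mem_multSet hΓ u.2 (?_ : (u : U g) • n = (u : U g) • m)).symm
  rw [Submonoid.smul_def] at h1
  rw [h1, h3]

theorem toLoc_surjective (hΓ : IsGammaBijective T Γ M) : Function.Surjective (toLoc T Γ M) := by
  intro v
  obtain ⟨s, hs, m, hm⟩ := exists_toUF_smul_eq v
  obtain ⟨n, rfl⟩ := smul_surjective_of_mem_multSet hΓ hs m
  refine ⟨n, ((isUnit_toUF T Γ hs).smul_left_cancel.mp ?_)⟩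
  rw [hm, toUF_smul_toLoc]

/-- `𝒟_Γ M ≃ M` if and only if `M` is `Γ`-bijective. -/
theorem nonempty_loc_equiv_iff (hΓ : IsGammaInjective T Γ M) :
    Nonempty (Loc T Γ M ≃ₗ[U g] M) ↔ IsGammaBijective T Γ M := by
  constructor
  · rintro ⟨e⟩ j
    refine ⟨hΓ j, fun m => ?_⟩
    refine ⟨e (((fUnit T Γ j)⁻¹ : (UF T Γ)ˣ) • e.symm m), ?_⟩
    change toU (T.f (Γ.root j)) • e _ = m
    rw [← map_smul, smul_loc_eq]
    change e (fUnit T Γ j • (fUnit T Γ j)⁻¹ • e.symm m) = m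
    rw [smul_inv_smul, LinearEquiv.apply_symm_apply]
  · intro h
    exact ⟨(LinearEquiv.ofBijective (toLoc T Γ M)
      ⟨toLoc_injective hΓ, toLoc_surjective h⟩).symm⟩

end LocalizedModules

/-! ### Weight spaces of the localization. -/

section LocalizedWeights

variable {g : Type*} [LieRing g] [LieAlgebra ℂ g] [IsSpOrSl g] {H : LieSubalgebra ℂ g}
  [H.IsCartanSubalgebra] {l : ℕ} {T : StandardTriples H} {Γ : CommutingRoots H l}
  {M : Type*} [AddCommGroup M] [Module ℂ M] [Module (U g) M] [IsScalarTower ℂ (U g) M]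

theorem toLoc_smul (c : ℂ) (m : M) : toLoc T Γ M (c • m) = c • toLoc T Γ M m := by
  rw [← algebraMap_smul (U g) c m, map_smul, algebraMap_smul]

theorem mem_weightSpace_loc {ν : Module.Dual ℂ H} {v : Loc T Γ M} :
    v ∈ weightSpace H (Loc T Γ M) ν ↔ ∀ h : H, toUF T Γ (toU (h : g)) • v = ν h • v := by
  rw [mem_weightSpace]
  simp only [smul_loc_eq]

theorem toLoc_mem_weightSpace_iff (hΓ : IsGammaInjective T Γ M) {ν : Module.Dual ℂ H} {m : M} :
    toLoc T Γ M m ∈ weightSpace H (Loc T Γ M) ν ↔ m ∈ weightSpace H M ν := by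
  rw [mem_weightSpace, mem_weightSpace]
  refine forall_congr' fun h => ?_
  rw [← map_smul, ← toLoc_smul, (toLoc_injective hΓ).eq_iff]

theorem HasWeight.smul_mem {w : UF T Γ} {κ : Module.Dual ℂ H} (hw : HasWeight T Γ w κ)
    {ν : Module.Dual ℂ H} {v : Loc T Γ M} (hv : v ∈ weightSpace H (Loc T Γ M) ν) :
    w • v ∈ weightSpace H (Loc T Γ M) (ν + κ) := by
  rw [mem_weightSpace_loc] at hv ⊢
  intro h
  rw [← mul_smul, hw h, add_smul, mul_smul, hv h, smul_comm, smul_assoc, ← add_smul,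
    LinearMap.add_apply]

/-- The weight spaces of `𝒟_Γ M` in a coset of `Span_ℤ Γ` are isomorphic. -/
theorem nonempty_weightSpace_loc_equiv {ν ν' : Module.Dual ℂ H} (h : ν' - ν ∈ intSpan Γ) :
    Nonempty (weightSpace H (Loc T Γ M) ν ≃ₗ[ℂ] weightSpace H (Loc T Γ M) ν') := by
  obtain ⟨w, hw⟩ := exists_unit_hasWeight T Γ h
  exact ⟨{
    toFun := fun v => ⟨(w : UF T Γ) • v.1, by simpa using hw.smul_mem v.2⟩
    invFun := fun v => ⟨((w⁻¹ : (UF T Γ)ˣ) : UF T Γ) • v.1, by simpa using hw.inv.smul_mem v.2⟩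
    map_add' := fun v v' => Subtype.ext (smul_add _ _ _)
    map_smul' := fun c v => Subtype.ext (smul_comm _ _ _)
    left_inv := fun v => Subtype.ext (by simp [← mul_smul])
    right_inv := fun v => Subtype.ext (by simp [← mul_smul]) }⟩

/-- A common denominator is itself a weight vector of `U_{F_Γ}`, so the numerators all have one
weight. -/
theorem exists_toLoc_weight {ν : Module.Dual ℂ H} (hΓ : IsGammaInjective T Γ M)
    (F : Finset (weightSpace H (Loc T Γ M) ν)) :
    ∃ s ∈ multSet T Γ, ∃ ν', ν' - ν ∈ intSpan Γ ∧ ∀ v ∈ F, ∃ m ∈ weightSpace H M ν',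
      toUF T Γ s • (v : Loc T Γ M) = toLoc T Γ M m := by
  classical
  obtain ⟨s, hs, h⟩ := exists_common_toUF_smul_eq (F.image Subtype.val)
  obtain ⟨κ, hκ, hw⟩ := exists_hasWeight_of_mem_multSet hs
  refine ⟨s, hs, ν + κ, by simpa using hκ, fun v hv => ?_⟩
  obtain ⟨m, hm⟩ := h v (Finset.mem_image_of_mem _ hv)
  refine ⟨m, ?_, hm⟩
  rw [← toLoc_mem_weightSpace_iff hΓ, ← hm]
  exact hw.smul_mem v.2

theorem mem_supp_loc_iff (hΓ : IsGammaInjective T Γ M) {ν : Module.Dual ℂ H} :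
    ν ∈ supp H (Loc T Γ M) ↔ ∃ ν' ∈ supp H M, ν' - ν ∈ intSpan Γ := by
  constructor
  · intro h
    obtain ⟨v, hv, hv0⟩ := mem_supp_iff.mp h
    obtain ⟨s, hs, ν', hν', h⟩ := exists_toLoc_weight hΓ {⟨v, hv⟩}
    obtain ⟨m, hm, hsm⟩ := h _ (Finset.mem_singleton_self _)
    refine ⟨ν', mem_supp_iff.mpr ⟨m, hm, ?_⟩, hν'⟩
    rintro rfl
    rw [map_zero] at hsm
    exact hv0 ((isUnit_toUF T Γ hs).smul_eq_zero.mp hsm)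
  · rintro ⟨ν', h, hν⟩
    obtain ⟨m, hm, hm0⟩ := mem_supp_iff.mp h
    obtain ⟨e⟩ := nonempty_weightSpace_loc_equiv (T := T) (M := M) hν
    refine mem_supp_iff.mpr
      ⟨_, (e.symm ⟨_, (toLoc_mem_weightSpace_iff hΓ).mpr hm⟩).2, fun h0 => hm0 ?_⟩
    rw [ZeroMemClass.coe_eq_zero, LinearEquiv.map_eq_zero_iff] at h0
    have h1 := congrArg (fun z : weightSpace H (Loc T Γ M) ν' => (z : Loc T Γ M)) h0
    exact toLoc_injective hΓ (h1.trans (map_zero _).symm)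

/-- The dimension of the weight spaces of `𝒟_Γ M` is the maximal dimension of the weight spaces of
`M` in the same coset of `Span_ℤ Γ`. -/
theorem finrank_weightSpace_loc (hΓ : IsGammaInjective T Γ M)
    (hfd : ∀ ν, FiniteDimensional ℂ (weightSpace H M ν)) (C : ℕ)
    (hC : ∀ ν, Module.finrank ℂ (weightSpace H M ν) ≤ C) {ν₀ ν' : Module.Dual ℂ H}
    (hν : ν' - ν₀ ∈ intSpan Γ) :
    FiniteDimensional ℂ (weightSpace H (Loc T Γ M) ν') ∧
      IsGreatest {d : ℕ | ∃ ν : Module.Dual ℂ H, ν - ν₀ ∈ intSpan Γ ∧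
        d = Module.finrank ℂ (weightSpace H M ν)}
        (Module.finrank ℂ (weightSpace H (Loc T Γ M) ν')) := by
  classical
  set D : Set ℕ := {d : ℕ | ∃ ν : Module.Dual ℂ H, ν - ν₀ ∈ intSpan Γ ∧
    d = Module.finrank ℂ (weightSpace H M ν)} with hD
  have hne : D.Nonempty := ⟨_, ν₀, by simp, rfl⟩
  have hbdd : BddAbove D := ⟨C, by rintro _ ⟨ν, -, rfl⟩; exact hC ν⟩
  have hmax : IsGreatest D (sSup D) :=
    ⟨Nat.sSup_mem hne hbdd, fun d hd => le_csSup hbdd hd⟩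
  -- A finite independent family is carried by a common denominator, acting invertibly, to an
  -- independent family in one weight space of `M`.
  have hrank : Module.rank ℂ (weightSpace H (Loc T Γ M) ν') ≤ (sSup D : ℕ) := by
    refine rank_le fun F hF => ?_
    obtain ⟨s, hs, κ, hκ, h⟩ := exists_toLoc_weight hΓ F
    choose m hm hsm using fun v : F => h v.1 v.2
    have hinj : LinearIndependent ℂ fun v : F => (⟨m v, hm v⟩ : weightSpace H M κ) := by
      have h1 : LinearIndependent ℂ fun v : F => toUF T Γ s • v.1.1 := by
        have h2 : LinearIndependent ℂ fun v : F => v.1.1 :=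
          hF.map' (Submodule.subtype _) (Submodule.ker_subtype _)
        exact h2.map' (Algebra.lsmul ℂ ℂ (Loc T Γ M) (toUF T Γ s))
          (LinearMap.ker_eq_bot.mpr fun v v' h => (isUnit_toUF T Γ hs).smul_left_cancel.mp h)
      simp only [hsm] at h1
      let φ : weightSpace H M κ →ₗ[ℂ] Loc T Γ M :=
        { toFun := fun v => toLoc T Γ M v
          map_add' := fun v v' => map_add _ _ _
          map_smul' := fun c v => toLoc_smul c _ }
      exact LinearIndependent.of_comp φ h1
    have h3 := hinj.fintype_card_le_finrank
    rw [Fintype.card_coe] at h3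
    refine h3.trans (hmax.2 ⟨κ, ?_, rfl⟩)
    simpa using Submodule.add_mem _ hκ hν
  have hfdL : FiniteDimensional ℂ (weightSpace H (Loc T Γ M) ν') :=
    Module.rank_lt_aleph0_iff.mp (hrank.trans_lt (Cardinal.natCast_lt_aleph0))
  refine ⟨hfdL, ?_⟩
  convert hmax using 1
  refine le_antisymm (Module.finrank_le_of_rank_le hrank) ?_
  -- Conversely, the largest weight space of `M` embeds in the localization and is moved to weight
  -- `ν'` by a unit.
  obtain ⟨κ, hκ, hk⟩ := hmax.1
  obtain ⟨e⟩ := nonempty_weightSpace_loc_equiv (T := T) (M := M) (Γ := Γ) (ν := κ) (ν' := ν')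
    (by simpa using Submodule.sub_mem _ hν hκ)
  rw [hk, ← e.finrank_eq]
  have := Module.Finite.equiv e.symm
  exact LinearMap.finrank_le_finrank_of_injective
    (f := ({ toFun := fun v => ⟨toLoc T Γ M v, (toLoc_mem_weightSpace_iff hΓ).mpr v.2⟩
             map_add' := fun v v' => Subtype.ext (map_add _ _ _)
             map_smul' := fun c v => Subtype.ext (toLoc_smul c _) } :
      weightSpace H M κ →ₗ[ℂ] weightSpace H (Loc T Γ M) κ))
    fun v v' h => Subtype.ext (toLoc_injective hΓ
      (congrArg (fun z : weightSpace H (Loc T Γ M) κ => (z : Loc T Γ M)) h))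

end LocalizedWeights

/-! ### The generalized conjugation as a product of binomial series. -/

section ThetaProduct

variable {A : Type*} [Ring A] [Algebra ℂ A] {l : ℕ}

/-- With `t j` equal to conjugation by `f j` minus the identity, the multiple sum factors into
truncated series for `(1 + t j)^{x j}`, since the `t j` commute and their `N`-th powers kill `u`. -/
theorem theta_eq_prod (f : Fin l → Aˣ) {C : Subalgebra ℂ (Module.End ℂ A)}
    (hC : ∀ a b : C, a * b = b * a) (t : Fin l → C)
    (hτ : ∀ (i : Fin l → ℕ) (u : A), (List.ofFn fun j => adEnd (f j : A) ^ i j).prod u *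
      (List.ofFn fun j => (((f j)⁻¹ ^ i j : Aˣ) : A)).prod =
        ((List.ofFn fun j => t j ^ i j).prod).1 u)
    (x : Fin l → ℂ) (u : A) (N : ℕ) (hN : ∀ j, (t j ^ N).1 u = 0) :
    theta f x u = ((List.ofFn fun j =>
      ∑ k ∈ Finset.range N, Ring.choose (x j) k • t j ^ k).prod : C).1 u := by
  let _ : CommRing C := { (inferInstance : Ring C) with mul_comm := hC }
  rw [List.prod_ofFn, Finset.prod_univ_sum]
  have happ : ∀ p : C, p.1 u = (LinearMap.applyₗ u ∘ₗ C.val.toLinearMap) p := fun p => rfl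
  rw [happ, map_sum]
  unfold theta
  simp only [hτ, List.prod_ofFn]
  have hterm : ∀ i : Fin l → ℕ, (∏ j, Ring.choose (x j) (i j) • t j ^ i j : C) =
      (∏ j, Ring.choose (x j) (i j)) • ∏ j, t j ^ i j := fun i => by
    simp only [Algebra.smul_def, map_prod, Finset.prod_mul_distrib]
  rw [finsum_eq_sum_of_support_subset (s := Fintype.piFinset fun _ : Fin l => Finset.range N)]
  · refine Finset.sum_congr rfl fun i _ => ?_
    rw [hterm, map_smul, ← happ]
  · intro i hi
    rw [Finset.mem_coe, Fintype.mem_piFinset]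
    by_contra! hcon
    obtain ⟨j, hj⟩ := hcon
    apply hi
    obtain ⟨q, hq⟩ : t j ^ N ∣ ∏ j, t j ^ i j :=
      (pow_dvd_pow _ (by simpa using hj)).trans (Finset.dvd_prod_of_mem _ (Finset.mem_univ j))
    have : (∏ j, t j ^ i j : C).1 u = 0 := by
      rw [hq, mul_comm]
      change q.1 ((t j ^ N).1 u) = 0
      rw [hN, map_zero]
    change _ • (∏ j, t j ^ i j : C).1 u = 0
    rw [this, smul_zero]

/-- On `C u ≅ C / Ann(u)` the map is multiplication by the product of the series. Each `t j` is
nilpotent in this quotient and each series has constant term `1`, so the product is a unit there and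
`u` is in the image. -/
theorem theta_surjective (f : Fin l → Aˣ) (hf : ∀ i j, Commute (f i : A) (f j))
    (hnil : ∀ j (u : A), ∃ N : ℕ, (adEnd (f j : A) ^ N) u = 0) (x : Fin l → ℂ) :
    Function.Surjective (theta f x) := by
  intro u
  obtain ⟨C, hC, t, -, hnil, hτ⟩ := exists_theta_eq f hf hnil
  let _ : CommRing C := { (inferInstance : Ring C) with mul_comm := hC }
  choose N hN using fun j => hnil j u
  -- The extra `1` ensures that the truncated series contains its constant term.
  let K := ∑ j, N j + 1
  have hK : ∀ j, (t j ^ K).1 u = 0 := by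
    intro j
    have hle : N j ≤ K := (Finset.single_le_sum (f := N) (fun _ _ => Nat.zero_le _)
      (Finset.mem_univ j)).trans (Nat.le_succ _)
    obtain ⟨k, hk⟩ := Nat.exists_eq_add_of_le' hle
    rw [hk, pow_add]
    change (t j ^ k).1 ((t j ^ N j).1 u) = 0
    rw [hN, map_zero]
  let p : Fin l → C := fun j => ∑ k ∈ Finset.range K, Ring.choose (x j) k • t j ^ k
  have hcu : ∀ c : C, theta f x (c.1 u) = ((∏ j, p j) * c).1 u := by
    intro c
    rw [theta_eq_prod f hC t hτ x (c.1 u) K (fun j => by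
      change (t j ^ K * c).1 u = 0
      rw [mul_comm]
      change c.1 ((t j ^ K).1 u) = 0
      rw [hK, map_zero]), List.prod_ofFn]
    rfl
  let a : Ideal C :=
    { carrier := {c | c.1 u = 0}
      add_mem' := fun {c d} hc hd => by
        change c.1 u + d.1 u = 0
        rw [show c.1 u = 0 from hc, show d.1 u = 0 from hd, add_zero]
      zero_mem' := rfl
      smul_mem' := fun c d hd => by
        change c.1 (d.1 u) = 0
        rw [show d.1 u = 0 from hd, map_zero] }
  have hunit : IsUnit (Ideal.Quotient.mk a (∏ j, p j)) := by
    rw [map_prod]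
    refine Finset.prod_induction _ IsUnit (fun _ _ => IsUnit.mul) isUnit_one fun j _ => ?_
    have h1 : IsNilpotent (Ideal.Quotient.mk a (t j)) :=
      ⟨K, by rw [← map_pow]; exact Ideal.Quotient.eq_zero_iff_mem.mpr (hK j)⟩
    have h2 : p j = 1 + ∑ k ∈ Finset.range (∑ j, N j), Ring.choose (x j) (k + 1) • t j ^ (k + 1) := by
      simp only [p, K]
      rw [Finset.sum_range_succ', add_comm]
      simp
    rw [h2, map_add, map_one]
    refine IsNilpotent.isUnit_one_add ?_
    rw [map_sum, ← mem_nilradical]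
    refine Ideal.sum_mem _ fun k _ => ?_
    rw [pow_succ, Algebra.smul_def, ← mul_assoc, map_mul]
    exact Ideal.mul_mem_left _ _ (mem_nilradical.mpr h1)
  obtain ⟨d, hd⟩ := hunit.exists_right_inv
  obtain ⟨c, rfl⟩ := Ideal.Quotient.mk_surjective d
  refine ⟨c.1 u, ?_⟩
  rw [hcu]
  rw [← map_mul, ← map_one (Ideal.Quotient.mk a), Ideal.Quotient.eq] at hd
  have h3 : ((∏ j, p j) * c).1 u - u = 0 := hd
  exact sub_eq_zero.mp h3

/-- Here `t j` maps `u` to a scalar and kills scalars, so only the constant and linear terms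
survive. -/
theorem theta_eq_add_of_conj_eq (f : Fin l → Aˣ) (hf : ∀ i j, Commute (f i : A) (f j))
    (hnil : ∀ j (u : A), ∃ N : ℕ, (adEnd (f j : A) ^ N) u = 0) (x : Fin l → ℂ) {u : A}
    (c : Fin l → ℂ) (hu : ∀ j, f j * u * ((f j)⁻¹ : Aˣ) = u + c j • 1) :
    theta f x u = u + (∑ j, x j * c j) • 1 := by
  obtain ⟨C, hC, t, hconj, -, hτ⟩ := exists_theta_eq f hf hnil
  let _ : CommRing C := { (inferInstance : Ring C) with mul_comm := hC }
  have ht1 : ∀ j, (t j).1 1 = 0 := by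
    intro j
    have h := hconj j 1
    rw [mul_one, Units.mul_inv] at h
    exact add_eq_left.mp h
  have htu : ∀ j, (t j).1 u = c j • 1 := by
    intro j
    have h := hconj j u
    rw [hu] at h
    exact add_left_cancel h
  rw [theta_eq_prod f hC t hτ x u 2 (fun j => by
    rw [sq]
    change (t j).1 ((t j).1 u) = 0
    rw [htu, map_smul, ht1, smul_zero]), List.prod_ofFn]
  have hp : ∀ j, ∑ k ∈ Finset.range 2, Ring.choose (x j) k • t j ^ k = 1 + x j • t j := by
    intro j
    simp [Finset.sum_range_succ]
  simp only [hp]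
  have key : ∀ s : Finset (Fin l), (∏ j ∈ s, (1 + x j • t j) : C).1 1 = 1 ∧
      (∏ j ∈ s, (1 + x j • t j) : C).1 u = u + (∑ j ∈ s, x j * c j) • 1 := by
    intro s
    classical
    induction s using Finset.induction_on with
    | empty => simp
    | insert j s hj ih =>
      rw [Finset.prod_insert hj, Finset.sum_insert hj]
      constructor
      · change (1 + x j • t j : C).1 ((∏ j ∈ s, (1 + x j • t j) : C).1 1) = _
        rw [ih.1]
        change 1 + x j • (t j).1 1 = 1
        rw [ht1, smul_zero, add_zero]
      · change (1 + x j • t j : C).1 ((∏ j ∈ s, (1 + x j • t j) : C).1 u) = _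
        rw [ih.2]
        change u + _ + x j • (t j).1 (u + _) = _
        rw [map_add, map_smul, ht1, htu, smul_zero, add_zero, smul_smul]
        module
  exact (key Finset.univ).2

end ThetaProduct

/-! ### Twisted localization and its direct summands. -/

section TwistedLocalization

variable {g : Type*} [LieRing g] [LieAlgebra ℂ g] [IsSpOrSl g] {H : LieSubalgebra ℂ g}
  [H.IsCartanSubalgebra] {l : ℕ} {T : StandardTriples H} {Γ : CommutingRoots H l}

theorem Theta_surjective (x : Fin l → ℂ) : Function.Surjective (Theta T Γ x) :=
  theta_surjective (fUnit T Γ) (commute_fUnit T Γ) (exists_adEnd_fUnit_pow_eq_zero T Γ) x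

/-- Since `f_γ` has weight `-γ`, conjugation by it sends `h` to `h + γ(h)`. -/
theorem Theta_toUF_cartan (x : Fin l → ℂ) (h : H) :
    Theta T Γ x (toUF T Γ (toU (h : g))) =
      toUF T Γ (toU (h : g)) + (∑ j, x j • Γ.root j) h • 1 := by
  have := theta_eq_add_of_conj_eq (fUnit T Γ) (commute_fUnit T Γ)
    (exists_adEnd_fUnit_pow_eq_zero T Γ) x (u := toUF T Γ (toU (h : g)))
    (fun j => Γ.root j h) (fun j => by
      rw [Units.mul_inv_eq_iff_eq_mul, add_mul, smul_mul_assoc, one_mul, HasWeight.fUnit j h,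
        LinearMap.neg_apply, neg_smul, neg_add_cancel_right])
  have h2 : (∑ j, x j • Γ.root j) h = ∑ j, x j * Γ.root j h := by
    simp [LinearMap.sum_apply]
  rw [h2]
  exact this

variable {M : Type*} [AddCommGroup M] [Module (U g) M]

theorem toU_smul_twLoc (x : Fin l → ℂ) (u : U g) (v : TwLoc T Γ x M) :
    u • v = (Theta T Γ x (toUF T Γ u) • (show Loc T Γ M from v) : Loc T Γ M) := rfl

/-- A direct summand of `𝒟_Γ^μ M` is stable under `U_{F_Γ}` acting on `𝒟_Γ M`. -/
theorem smul_mem_of_isCompl (x : Fin l → ℂ) {N₁ N₂ : Submodule (U g) (TwLoc T Γ x M)}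
    (hN : IsCompl N₁ N₂) (w : UF T Γ) {v : Loc T Γ M} (hv : (show TwLoc T Γ x M from v) ∈ N₁) :
    (show TwLoc T Γ x M from (w • v : Loc T Γ M)) ∈ N₁ := by
  obtain ⟨w, rfl⟩ := Theta_surjective x w
  induction w using OreLocalization.ind with | _ r s
  have hunit : IsUnit (Theta T Γ x (toUF T Γ s)) := (isUnit_toUF T Γ s.2).map _
  have hrs : toUF T Γ s * (r /ₒ s) = toUF T Γ r := OreLocalization.smul_cancel
  -- Split the image of `v` under `Θ_x(s⁻¹ r)` as `a + b`. Applying `s` gives `r v ∈ N₁`, so `s b`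
  -- lies in both summands and vanishes; `s` acts invertibly, hence `b = 0`.
  obtain ⟨a, ha, b, hb, hab⟩ := Submodule.mem_sup.mp (show
    (show TwLoc T Γ x M from (Theta T Γ x (r /ₒ s) • v : Loc T Γ M)) ∈ N₁ ⊔ N₂ by
      rw [hN.sup_eq_top]; trivial)
  have h1 : (s : U g) • a + (s : U g) • b = r • (show TwLoc T Γ x M from v) := by
    rw [← smul_add, hab, toU_smul_twLoc, toU_smul_twLoc, ← hrs, map_mul, mul_smul]
  have h2 : (s : U g) • b ∈ N₁ := by
    rw [← eq_sub_iff_add_eq'] at h1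
    rw [h1]
    exact N₁.sub_mem (N₁.smul_mem _ hv) (N₁.smul_mem _ ha)
  have h3 : (s : U g) • b = 0 := Submodule.disjoint_def.mp hN.disjoint _ h2 (N₂.smul_mem _ hb)
  have h4 : ∀ c : Loc T Γ M, Theta T Γ x (toUF T Γ s) • c = 0 → c = 0 := fun c hc =>
    hunit.smul_eq_zero.mp hc
  rw [← hab, show b = 0 from h4 b h3, add_zero]
  exact ha

/-- The trace on `M` of a direct summand of `𝒟_Γ^μ M`. -/
def traceSummand (x : Fin l → ℂ) {N₁ N₂ : Submodule (U g) (TwLoc T Γ x M)}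
    (hN : IsCompl N₁ N₂) : Submodule (U g) M where
  carrier := {m | (show TwLoc T Γ x M from toLoc T Γ M m) ∈ N₁}
  add_mem' {m n} hm hn := by
    rw [Set.mem_ofPred_eq, map_add]; exact N₁.add_mem hm hn
  zero_mem' := by
    rw [Set.mem_ofPred_eq, map_zero]; exact N₁.zero_mem
  smul_mem' u m hm := by
    rw [Set.mem_ofPred_eq, ← toUF_smul_toLoc]
    exact smul_mem_of_isCompl x hN _ hm

theorem traceSummand_ne_bot (x : Fin l → ℂ) {N₁ N₂ : Submodule (U g) (TwLoc T Γ x M)}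
    (hN : IsCompl N₁ N₂) (h : N₁ ≠ ⊥) : traceSummand x hN ≠ ⊥ := by
  obtain ⟨v, hv, hv0⟩ := N₁.ne_bot_iff.mp h
  obtain ⟨s, hs, m, hm⟩ := exists_toUF_smul_eq (show Loc T Γ M from v)
  refine (Submodule.ne_bot_iff _).mpr ⟨m, ?_, ?_⟩
  · change (show TwLoc T Γ x M from toLoc T Γ M m) ∈ N₁
    rw [← hm]
    exact smul_mem_of_isCompl x hN _ hv
  · rintro rfl
    rw [map_zero] at hm
    have h1 : ∀ c : Loc T Γ M, toUF T Γ s • c = 0 → c = 0 := fun c hc =>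
      (isUnit_toUF T Γ hs).smul_eq_zero.mp hc
    exact hv0 (h1 v hm)

/-- In a nontrivial decomposition both summands would have nonzero trace on `M`, so both traces
would contain the unique simple submodule, although the summands are disjoint. -/
theorem isIndecomposable_twLoc (hΓ : IsGammaInjective T Γ M)
    (hsimple : ∀ K : Submodule (U g) M, K ≠ ⊥ → ∃ S ≤ K, IsSimpleModule (U g) S)
    (huniq : ∃! N : Submodule (U g) M, IsSimpleModule (U g) N) (x : Fin l → ℂ) :
    IsIndecomposable (U g) (TwLoc T Γ x M) := by
  obtain ⟨S, hS, huniq⟩ := huniq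
  have hS' : S ≠ ⊥ := (isSimpleModule_iff_isAtom.mp hS).1
  obtain ⟨m, -, hm0⟩ := S.ne_bot_iff.mp hS'
  refine ⟨⟨⟨toLoc T Γ M m, (0 : Loc T Γ M), fun h => hm0 ?_⟩⟩, fun N₁ N₂ hN => ?_⟩
  · exact toLoc_injective hΓ (h.trans (map_zero _).symm)
  · by_contra! hne
    obtain ⟨S₁, hS₁, hs₁⟩ := hsimple _ (traceSummand_ne_bot x hN hne.1)
    obtain ⟨S₂, hS₂, hs₂⟩ := hsimple _ (traceSummand_ne_bot x hN.symm hne.2)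
    rw [huniq S₁ hs₁] at hS₁
    rw [huniq S₂ hs₂] at hS₂
    refine hS' ((Submodule.eq_bot_iff _).mpr fun n hn => ?_)
    have h := Submodule.disjoint_def.mp hN.disjoint _ (hS₁ hn) (hS₂ hn)
    exact toLoc_injective hΓ (h.trans (map_zero _).symm)

variable [Module ℂ M] [IsScalarTower ℂ (U g) M]

theorem mem_weightSpace_twLoc_iff (x : Fin l → ℂ) {ν : Module.Dual ℂ H} (v : TwLoc T Γ x M) :
    v ∈ weightSpace H (TwLoc T Γ x M) ν ↔
      (show Loc T Γ M from v) ∈ weightSpace H (Loc T Γ M) (ν - ∑ j, x j • Γ.root j) := by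
  rw [mem_weightSpace_loc, mem_weightSpace]
  refine forall_congr' fun h => ?_
  rw [toU_smul_twLoc, Theta_toUF_cartan, add_smul, smul_assoc, one_smul, LinearMap.sub_apply,
    sub_smul, eq_sub_iff_add_eq]
  rfl

/-- Twisting shifts weights. -/
noncomputable def weightSpaceTwLocEquiv (x : Fin l → ℂ) (ν : Module.Dual ℂ H) :
    weightSpace H (TwLoc T Γ x M) ν ≃ₗ[ℂ]
      weightSpace H (Loc T Γ M) (ν - ∑ j, x j • Γ.root j) where
  toFun v := ⟨v.1, (mem_weightSpace_twLoc_iff x v.1).mp v.2⟩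
  invFun v := ⟨v.1, (mem_weightSpace_twLoc_iff x v.1).mpr v.2⟩
  map_add' _ _ := rfl
  map_smul' _ _ := rfl

theorem mem_supp_twLoc_iff (x : Fin l → ℂ) {ν : Module.Dual ℂ H} :
    ν ∈ supp H (TwLoc T Γ x M) ↔ ν - ∑ j, x j • Γ.root j ∈ supp H (Loc T Γ M) := by
  rw [mem_supp_iff, mem_supp_iff]
  exact exists_congr fun v => and_congr_left' (mem_weightSpace_twLoc_iff x v)

end TwistedLocalization

end TwistedLoc

/-! ### The three assertions combined. -/

open scoped Pointwise in
theorem mainTheorem12 {g : Type*} [LieRing g] [LieAlgebra ℂ g] [TwistedLoc.IsSpOrSl g]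
    (H : LieSubalgebra ℂ g) [H.IsCartanSubalgebra] (T : TwistedLoc.StandardTriples H)
    {l : ℕ} (Γ : TwistedLoc.CommutingRoots H l)
    {M : Type*} [AddCommGroup M] [Module ℂ M] [Module (TwistedLoc.U g) M]
    [IsScalarTower ℂ (TwistedLoc.U g) M]
    (hM : TwistedLoc.IsBoundedModule H M) (hΓ : TwistedLoc.IsGammaInjective T Γ M) :
    (Nonempty (TwistedLoc.Loc T Γ M ≃ₗ[TwistedLoc.U g] M) ↔
      TwistedLoc.IsGammaBijective T Γ M) ∧
    (∀ (x : Fin l → ℂ) (μ : Module.Dual ℂ H), μ = ∑ j, x j • Γ.root j →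
      TwistedLoc.supp H (TwistedLoc.TwLoc T Γ x M) =
        {μ} + TwistedLoc.supp H M + (TwistedLoc.intSpan Γ : Set (Module.Dual ℂ H)) ∧
      ∀ ν₀ ∈ TwistedLoc.supp H M, ∀ ν' : Module.Dual ℂ H,
        ν' - (μ + ν₀) ∈ TwistedLoc.intSpan Γ →
        FiniteDimensional ℂ (TwistedLoc.weightSpace H (TwistedLoc.TwLoc T Γ x M) ν') ∧
        IsGreatest
          {d : ℕ | ∃ ν : Module.Dual ℂ H, ν - ν₀ ∈ TwistedLoc.intSpan Γ ∧
            d = Module.finrank ℂ (TwistedLoc.weightSpace H M ν)}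
          (Module.finrank ℂ (TwistedLoc.weightSpace H (TwistedLoc.TwLoc T Γ x M) ν'))) ∧
    ((∃! N : Submodule (TwistedLoc.U g) M, IsSimpleModule (TwistedLoc.U g) N) →
      TwistedLoc.IsIndecomposable (TwistedLoc.U g) M →
      ∀ x : Fin l → ℂ,
        TwistedLoc.IsIndecomposable (TwistedLoc.U g) (TwistedLoc.TwLoc T Γ x M)) := by
  classical
  obtain ⟨χ, hM⟩ := hM
  obtain ⟨C, hC⟩ := hM.exists_bound
  have htop := hM.isInternal.submodule_iSup_eq_top
  have hfd : ∀ ν, FiniteDimensional ℂ (TwistedLoc.weightSpace H M ν) := fun ν =>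
    Module.rank_lt_aleph0_iff.mp ((hC ν).trans Cardinal.natCast_lt_aleph0)
  have hC' : ∀ ν, Module.finrank ℂ (TwistedLoc.weightSpace H M ν) ≤ C := fun ν =>
    Module.finrank_le_of_rank_le (hC ν).le
  refine ⟨TwistedLoc.nonempty_loc_equiv_iff hΓ, ?_, fun huniq _ x =>
    TwistedLoc.isIndecomposable_twLoc hΓ
      (fun K hK => TwistedLoc.exists_isSimpleModule_le htop hfd C hC' hK) huniq x⟩
  rintro x μ rfl
  refine ⟨?_, fun ν₀ _ ν' hν => ?_⟩
  · ext ν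
    rw [TwistedLoc.mem_supp_twLoc_iff, TwistedLoc.mem_supp_loc_iff hΓ]
    simp only [Set.mem_add, Set.mem_singleton_iff, SetLike.mem_coe, exists_eq_left]
    constructor
    · rintro ⟨κ, hκ, h⟩
      exact ⟨_, ⟨κ, hκ, rfl⟩, _, Submodule.neg_mem _ h, by abel⟩
    · rintro ⟨_, ⟨κ, hκ, rfl⟩, δ, hδ, rfl⟩
      refine ⟨κ, hκ, ?_⟩
      convert Submodule.neg_mem _ hδ using 1
      abel
  -- Weight `ν'` of the twisted module is weight `ν' - μ` of the untwisted localization.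
  · obtain ⟨h1, h2⟩ := TwistedLoc.finrank_weightSpace_loc (T := T) hΓ hfd C hC'
      (ν₀ := ν₀) (ν' := ν' - ∑ j, x j • Γ.root j) (by rwa [sub_sub])
    have e := TwistedLoc.weightSpaceTwLocEquiv (T := T) (Γ := Γ) (M := M) x ν'
    rw [e.finrank_eq]
    exact ⟨Module.Finite.equiv e.symm, h2⟩
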